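/- Proposition (invariant modules of the spin Schrödinger operator). Let $N\ge 1$ be the number of particles, $M\in\frac12\mathbb N$ (possibly $M=0$) the spin, $m$ a non-negative integer, and let $a$ and $c_{++},c_{0+},c_{00},c_{0-},c_{--},c_+,c_0,c_-$ be real constants. Put $b=1+m+a(N-1)$ and \begin{align*} P(z)&=c_{++}z^4+c_{0+}z^3+c_{00}z^2+c_{0-}z+c_{--},\qquad Q(z)=c_+z^2+c_0z+c_-,\\ \tilde Q(z)&=Q(z)+\Big(1-\frac b2\Big)P'(z),\\ R(z)&=c_{++}\big(b+m(m-2)-1\big)z^2+\Big[c_{0+}\Big(\Big(1-\frac m2\Big)b+m(m-1)-1\Big)-mc_+\Big]z+\frac{c_{00}}4\big(2(b-1)+m(m-2)\big)-\frac m2c_0 . \end{align*} Let $\mathfrak S$ be the complex vector space with basis $|s_1,\dots,s_N\rangle$, $s_i\in\{-M,-M+1,\dots,M\}$, let $S_{ij}$ be the operator on $\mathfrak S$ that exchanges $s_i$ and $s_j$, and let $\Lambda=\sum_{\pi}\operatorname{sgn}(\pi)\,\Pi_\pi$ be the antisymmetrizer on $\mathbb C[z_1,\dots,z_N]\otimes\mathfrak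 S$ with respect to simultaneous permutations $\Pi_\pi$ of the coordinates and the spins. Let $U\subset\mathbb R^N$ be a nonempty open set and let $z_i=\zeta_i(x_i)$, $i=1,\dots,N$, be a real change of variables such that, for $\mathbf x\in U$, one has $P(\zeta_i(x_i))>0$, $\zeta_i$ is differentiable at $x_i$ with $\zeta_i'(x_i)^2=P(\zeta_i(x_i))$ (that is, $x_i=\int^{z_i}dy/\sqrt{P(y)}$, with either sign of the square root and up to a translation of each coordinate), and $\zeta_i(x_i)\ne\zeta_j(x_j)$ for $i\ne j$. Let $E$ be a real function with $E'=\tilde Q/(2P)$ at all points $\zeta_i(x_i)$, $\mathbf x\in U$, and let $$\mu(\mathbf z)=\prod_{i<j}(z_i-z_j)^a\ \prod_{i=1}^N P(z_i)^{-1/4}\,e^{E(z_i)},$$ the powers of $z_i-z_j$ being principal complex powers. Let $H=-\sum_i\partial_{x_i}^2+V(\mathbf x)$ act on $\mathfrak S$-valued functions on $U$, where $V(\mathbf x)$ is the following expression at $\mathbf z=\boldsymbol\zeta(\mathbf x)=(\zeta_1(x_1),\dots,\zeta_N(x_N))$ ($\sum'_{i,j,k}$ is the sum over pairwise different $i,j,k$):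 \begin{align*} V={}&a^2\,{\sum_{i,j,k}}'\frac{P(z_i)}{(z_i-z_j)(z_i-z_k)}+a\sum_{i\ne j}\frac{\tilde Q(z_i)}{z_i-z_j}+a\sum_{i<j}\frac{P(z_i)+P(z_j)}{(z_i-z_j)^2}(a+S_{ij})-2ac_{++}(1-m)\sum_{i<j}z_iz_j\\ &-a\sum_{i<j}\big(c_{++}(z_i+z_j)^2+c_{0+}(z_i+z_j)+c_{00}\big)S_{ij}\\ &+\frac14\sum_i\Big[\frac1{P(z_i)}\Big(\frac34P'(z_i)^2+\tilde Q(z_i)^2-2\tilde Q(z_i)P'(z_i)\Big)-P''(z_i)+2\tilde Q'(z_i)-4R(z_i)\Big]\\ &-\frac{a^2}{12}c_{00}\,{\sum_{i,j,k}}'\big(1-S_{ij}S_{ik}\big). \end{align*} For $n\ge0$ let $\mathcal R_n(\mathbf z)$ (respectively $\mathcal P_n(\mathbf z)$) be the span of the monomials $\prod_iz_i^{l_i}$ with $l_i\le n$ for all $i$ (respectively $\sum_il_i\le n$), and define the spaces of functions on $U$ $$\mathcal M_n=\mu\big(\boldsymbol\zeta(\mathbf x)\big)\,\Lambda\big(\mathcal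 R_n\otimes\mathfrak S\big)\big|_{\mathbf z=\boldsymbol\zeta(\mathbf x)},\qquad \mathcal N_n=\mu\big(\boldsymbol\zeta(\mathbf x)\big)\,\Lambda\big(\mathcal P_n\otimes\mathfrak S\big)\big|_{\mathbf z=\boldsymbol\zeta(\mathbf x)} .$$ (i) $\mathcal M_m$ is a finite-dimensional space of smooth functions on $U$ that is invariant under $H$. If $N\le(m+1)(2M+1)$, then $\mathcal M_m\ne0$, and hence $H$ is quasi-exactly solvable, i.e. it preserves a nonzero finite-dimensional space of smooth functions on $U$. (ii) If $c_{++}=c_{0+}=c_+=0$, then for every $n\ge0$ both $\mathcal M_n$ and $\mathcal N_n$ are finite-dimensional spaces of smooth functions on $U$ that are invariant under $H$, and there are infinitely many different spaces in each of the sequences $(\mathcal M_n)_n$ and $(\mathcal N_n)_n$. Hence $H$ is exactly solvable, i.e. it preserves an infinite increasing sequence (an increasing sequence with infinitely many different terms) of finite-dimensional spaces of smooth functions on $U$. -/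

import Mathlib

open scoped ContDiff

noncomputable section

namespace SpinCS

/-- The real parameters `a`, `c_{++}, c_{0+}, c_{00}, c_{0-}, c_{--}, c_+, c_0, c_-` and the
non-negative integer `m` on which the models depend. -/
structure Params where
  a : ℝ
  m : ℕ
  cpp : ℝ
  c0p : ℝ
  c00 : ℝ
  c0m : ℝ
  cmm : ℝ
  cp : ℝ
  c0 : ℝ
  cm : ℝ

section Polynomials

open Polynomial

variable (N : ℕ) (p : Params)

/-- `b = 1 + m + a (N - 1)`. -/
def bConst : ℝ := 1 + p.m + p.a * ((N : ℝ) - 1)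

/-- `P(z) = c_{++} z⁴ + c_{0+} z³ + c_{00} z² + c_{0-} z + c_{--}`. -/
def polyP : ℝ[X] :=
  C p.cpp * X ^ 4 + C p.c0p * X ^ 3 + C p.c00 * X ^ 2 + C p.c0m * X + C p.cmm

/-- `Q(z) = c_+ z² + c_0 z + c_-`. -/
def polyQ : ℝ[X] := C p.cp * X ^ 2 + C p.c0 * X + C p.cm

/-- `Q̃(z) = Q(z) + (1 - b/2) P'(z)`. -/
def polyQt : ℝ[X] := polyQ p + C (1 - bConst N p / 2) * derivative (polyP p)

/-- `R(z) = c_{++} (b + m(m-2) - 1) z² + [c_{0+} ((1 - m/2) b + m(m-1) - 1) - m c_+] z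
  + (c_{00}/4) (2(b-1) + m(m-2)) - (m/2) c_0`. -/
def polyR : ℝ[X] :=
  C (p.cpp * (bConst N p + (p.m : ℝ) * ((p.m : ℝ) - 2) - 1)) * X ^ 2
    + C (p.c0p * ((1 - (p.m : ℝ) / 2) * bConst N p + (p.m : ℝ) * ((p.m : ℝ) - 1) - 1)
        - (p.m : ℝ) * p.cp) * X
    + C (p.c00 / 4 * (2 * (bConst N p - 1) + (p.m : ℝ) * ((p.m : ℝ) - 2))
        - (p.m : ℝ) / 2 * p.c0)

end Polynomials

section Spin

/-- Spin configurations `(s_1, …, s_N)`. Each particle has `s + 1 = 2M + 1` spin states, labelled by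
`0, …, s` (the label `k` stands for the spin value `k - M`, where `s = 2M`). -/
abbrev Config (N s : ℕ) : Type := Fin N → Fin (s + 1)

/-- The spin space `𝔖`: a vector is given by its components in the basis `|s_1, …, s_N⟩`. -/
abbrev Spin (N s : ℕ) : Type := Config N s → ℂ

/-- Spin-valued polynomials, `ℂ[z_1, …, z_N] ⊗ 𝔖`, given by their components in the basis
`|s_1, …, s_N⟩`. -/
abbrev SpinPoly (N s : ℕ) : Type := Config N s → MvPolynomial (Fin N) ℂ

/-- The action of a permutation of the particles on the spin variables of a vector with spin
components in `A` (`A = ℂ` for `𝔖`, `A = ℂ[z]` for `ℂ[z] ⊗ 𝔖`). -/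
def spinPerm {N : ℕ} (s : ℕ) (A : Type) [AddCommMonoid A] [Module ℂ A]
    (π : Equiv.Perm (Fin N)) : Module.End ℂ (Config N s → A) :=
  LinearMap.funLeft ℂ A (fun σ : Config N s => σ ∘ π)

/-- The action of a permutation of the particles on the coordinates of a spin-valued polynomial,
`(K_π f)(z) = f(z ∘ π)`. -/
def coordPerm {N : ℕ} (s : ℕ) (π : Equiv.Perm (Fin N)) : Module.End ℂ (SpinPoly N s) where
  toFun F := fun σ => MvPolynomial.rename π (F σ)
  map_add' F G := by funext σ; simp
  map_smul' r F := by funext σ; simp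

/-- The spin exchange operator `S_{ij}` on `𝔖`. -/
def spinSwap {N : ℕ} (s : ℕ) (i j : Fin N) : Module.End ℂ (Spin N s) :=
  spinPerm s ℂ (Equiv.swap i j)

/-- `S_{ij}` exchanges the `i`-th and the `j`-th spin of a basis state. -/
theorem spinSwap_single {N s : ℕ} (i j : Fin N) (σ : Config N s) :
    spinSwap s i j (Pi.single σ (1 : ℂ)) = Pi.single (σ ∘ Equiv.swap i j) 1 := by
  funext τ
  have h : τ ∘ Equiv.swap i j = σ ↔ τ = σ ∘ Equiv.swap i j := by
    constructor
    · rintro rfl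
      funext k
      simp
    · rintro rfl
      funext k
      simp
  simp only [spinSwap, spinPerm, LinearMap.funLeft_apply, Pi.single_apply, h]

/-- The antisymmetrizer `Λ = ∑_π sgn(π) Π_π` under simultaneous permutations
`Π_π = K_π S_π` of the coordinates and the spins of the particles. -/
def antisymmetrizer (N s : ℕ) : Module.End ℂ (SpinPoly N s) :=
  ∑ π : Equiv.Perm (Fin N),
    ((Equiv.Perm.sign π : ℤ) : ℂ) • (coordPerm s π * spinPerm s (MvPolynomial (Fin N) ℂ) π)

/-- `W ⊗ 𝔖 ⊆ ℂ[z] ⊗ 𝔖` for a space `W` of scalar polynomials. -/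
def tensorSpin {N : ℕ} (s : ℕ) (W : Submodule ℂ (MvPolynomial (Fin N) ℂ)) :
    Submodule ℂ (SpinPoly N s) :=
  Submodule.pi Set.univ (fun _ => W)

/-- The rectangular module `R_n(z)`: all exponents are at most `n`. -/
def rectModule (N n : ℕ) : Submodule ℂ (MvPolynomial (Fin N) ℂ) :=
  MvPolynomial.restrictDegree (Fin N) ℂ n

/-- The triangular module `P_n(z)`: total degree at most `n`. -/
def triModule (N n : ℕ) : Submodule ℂ (MvPolynomial (Fin N) ℂ) :=
  MvPolynomial.restrictTotalDegree (Fin N) ℂ n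

end Spin

section Potential

open Polynomial Finset

/-- The matrix-valued potential, as a function of `z = ζ(x)`. In the triple sums the indices
`i, j, k` are pairwise different. -/
def potential {N : ℕ} (s : ℕ) (p : Params) (z : Fin N → ℝ) : Module.End ℂ (Spin N s) :=
  let P := polyP p
  let Qt := polyQt N p
  let R := polyR N p
  ((p.a ^ 2 * (∑ i, ∑ j with j ≠ i, ∑ k with k ≠ i ∧ k ≠ j,
        P.eval (z i) / ((z i - z j) * (z i - z k)))
      + p.a * (∑ i, ∑ j with j ≠ i, Qt.eval (z i) / (z i - z j))
      - 2 * p.a * p.cpp * (1 - (p.m : ℝ)) * (∑ i, ∑ j with i < j, z i * z j)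
      + 1 / 4 * (∑ i,
          (1 / P.eval (z i) *
            (3 / 4 * (derivative P).eval (z i) ^ 2 + Qt.eval (z i) ^ 2
              - 2 * Qt.eval (z i) * (derivative P).eval (z i))
          - (derivative (derivative P)).eval (z i)
          + 2 * (derivative Qt).eval (z i)
          - 4 * R.eval (z i))) : ℝ) : ℂ) • (1 : Module.End ℂ (Spin N s))
    + (p.a : ℂ) • (∑ i, ∑ j with i < j,
        (((P.eval (z i) + P.eval (z j)) / (z i - z j) ^ 2 : ℝ) : ℂ) •
          ((p.a : ℂ) • (1 : Module.End ℂ (Spin N s)) + spinSwap s i j))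
    - (p.a : ℂ) • (∑ i, ∑ j with i < j,
        ((p.cpp * (z i + z j) ^ 2 + p.c0p * (z i + z j) + p.c00 : ℝ) : ℂ) • spinSwap s i j)
    - ((p.a ^ 2 / 12 * p.c00 : ℝ) : ℂ) • (∑ i : Fin N, ∑ j with j ≠ i, ∑ k with k ≠ i ∧ k ≠ j,
        ((1 : Module.End ℂ (Spin N s)) - spinSwap s i j * spinSwap s i k))

/-- The gauge factor
`μ(z) = ∏_{i<j} (z_i - z_j)^a ∏_i P(z_i)^{-1/4} exp E(z_i)`, where `E` is an antiderivative of
`Q̃ / (2P)`. The powers of `z_i - z_j` are principal complex powers. -/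
def gauge {N : ℕ} (p : Params) (E : ℝ → ℝ) (z : Fin N → ℝ) : ℂ :=
  (∏ i, ∏ j with i < j, ((z i - z j : ℝ) : ℂ) ^ (p.a : ℂ)) *
    ∏ i, (((polyP p).eval (z i) ^ (-(1 / 4) : ℝ) * Real.exp (E (z i)) : ℝ) : ℂ)

end Potential

section Operators

variable {N s : ℕ}

/-- The change of variables `z = ζ(x)`, `z_i = ζ_i(x_i)`. -/
def changeVar (ζ : Fin N → ℝ → ℝ) (x : Fin N → ℝ) : Fin N → ℝ := fun i => ζ i (x i)

/-- Spin-valued functions on `ℝ^N`. A function on an open set `U` is represented by its extension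
by zero. -/
abbrev SpinFun (N s : ℕ) : Type := (Fin N → ℝ) → Spin N s

/-- The space `C^∞(U) ⊗ 𝔖` of smooth spin-valued functions on `U`. -/
def smoothFun (s : ℕ) (U : Set (Fin N → ℝ)) : Submodule ℂ (SpinFun N s) where
  carrier := {ψ | ContDiffOn ℝ ∞ ψ U ∧ ∀ x, x ∉ U → ψ x = 0}
  add_mem' := by
    rintro f g ⟨hf, hf'⟩ ⟨hg, hg'⟩
    exact ⟨hf.add hg, fun x hx => by simp [hf' x hx, hg' x hx]⟩
  zero_mem' := ⟨contDiffOn_const, fun _ _ => rfl⟩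
  smul_mem' := by
    rintro r f ⟨hf, hf'⟩
    exact ⟨hf.const_smul r, fun x hx => by simp [hf' x hx]⟩

/-- The Schrödinger operator `H = -∑_i ∂_{x_i}² + V(x)` on functions on `U`, where
`V(x)` is the potential at `z = ζ(x)`. -/
def hamiltonian (p : Params) (U : Set (Fin N → ℝ)) (ζ : Fin N → ℝ → ℝ) (ψ : SpinFun N s) :
    SpinFun N s :=
  U.indicator fun x =>
    -(∑ i, iteratedDeriv 2 (fun t : ℝ => ψ (Function.update x i t)) (x i))
      + potential s p (changeVar ζ x) (ψ x)

/-- The map `F ↦ μ(ζ(x)) F(ζ(x))` from spin-valued polynomials to spin-valued functions on `U`. -/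
def pullback (s : ℕ) (p : Params) (U : Set (Fin N → ℝ)) (ζ : Fin N → ℝ → ℝ) (E : ℝ → ℝ) :
    SpinPoly N s →ₗ[ℂ] SpinFun N s where
  toFun F := U.indicator fun x σ =>
    gauge p E (changeVar ζ x) * MvPolynomial.eval (fun i => (changeVar ζ x i : ℂ)) (F σ)
  map_add' F G := by
    funext x σ
    by_cases hx : x ∈ U <;> simp [hx, mul_add]
  map_smul' r F := by
    funext x σ
    by_cases hx : x ∈ U <;> simp [hx, mul_left_comm]

/-- `M_n = μ Λ(R_n(ζ(x)) ⊗ 𝔖)`. -/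
def modM (s : ℕ) (p : Params) (U : Set (Fin N → ℝ)) (ζ : Fin N → ℝ → ℝ) (E : ℝ → ℝ) (n : ℕ) :
    Submodule ℂ (SpinFun N s) :=
  ((tensorSpin s (rectModule N n)).map (antisymmetrizer N s)).map (pullback s p U ζ E)

/-- `N_n = μ Λ(P_n(ζ(x)) ⊗ 𝔖)`. -/
def modN (s : ℕ) (p : Params) (U : Set (Fin N → ℝ)) (ζ : Fin N → ℝ → ℝ) (E : ℝ → ℝ) (n : ℕ) :
    Submodule ℂ (SpinFun N s) :=
  ((tensorSpin s (triModule N n)).map (antisymmetrizer N s)).map (pullback s p U ζ E)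

/-- `W` is a finite-dimensional space of smooth functions on `U` that `H` leaves invariant. -/
structure IsInvariantSpace (U : Set (Fin N → ℝ)) (H : SpinFun N s → SpinFun N s)
    (W : Submodule ℂ (SpinFun N s)) : Prop where
  finiteDimensional : FiniteDimensional ℂ W
  smooth : W ≤ smoothFun s U
  invariant : ∀ ψ ∈ W, H ψ ∈ W

/-- Quasi-exact solvability: `H` preserves a nonzero finite-dimensional space of smooth
functions. -/
def IsQuasiExactlySolvable (U : Set (Fin N → ℝ)) (H : SpinFun N s → SpinFun N s) : Prop :=
  ∃ W : Submodule ℂ (SpinFun N s), W ≠ ⊥ ∧ IsInvariantSpace U H W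

/-- Exact solvability: `H` preserves an infinite increasing sequence of finite-dimensional spaces of
smooth functions. -/
def IsExactlySolvable (U : Set (Fin N → ℝ)) (H : SpinFun N s → SpinFun N s) : Prop :=
  ∃ W : ℕ → Submodule ℂ (SpinFun N s),
    Monotone W ∧ (Set.range W).Infinite ∧ ∀ n, IsInvariantSpace U H (W n)

end Operators

end SpinCS

end

/-!
Conjugation with the gauge factor `μ` turns `-H` into an operator on polynomials. In the variables
`z_i = ζ_i(x_i)` one has `∂_{x_i}² = P(z_i) ∂_i² + P'(z_i) ∂_i / 2`, because `ζ_i' ^ 2 = P(ζ_i)` and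
hence `ζ_i'' = P'(ζ_i) / 2`; the logarithmic derivative of `μ` with respect to `z_i` is
`a ∑_{j ≠ i} 1 / (z_i - z_j) + (Q̃ - P' / 2) / (2P)`. The three-body terms and the singular one-body
terms that arise cancel against the potential. On an antisymmetric spin polynomial the spin exchange
`S_{ij}` acts as minus the coordinate exchange `K_{ij}`, and what remains is a scalar operator
`gaugedHam`, which acts on each spin component separately (`Admissible.hamiltonian_pullback`).

Apart from products of exchanges `K_{ij}`, this operator is a combination of products of

* `D⁻_i = ∂_i`, `D⁰_i = z_i ∂_i - m / 2`, `D⁺_i = z_i² ∂_i - m z_i`, and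
* `A⁻_{ij} = (1 - K_{ij}) / (z_i - z_j)`, `A⁰_{ij} = (z_i + z_j) / 2 · A⁻_{ij}`,
  `A⁺_{ij} = z_i z_j A⁻_{ij}`,

the constituents of Dunkl operators. Written in this way it visibly maps polynomials to polynomials.
All six families preserve the rectangular module `R_m`, where for the operators `A` one uses that
degrees are additive: division of `f - K_{ij} f` by `z_i - z_j` lowers the degrees in `z_i` and
`z_j` by one. Only `D⁺` and `A⁺` can raise degrees; they come with the coefficients
`c_{++}, c_{0+}, c_+`. If these vanish, all the modules `R_n` and `P_n` are preserved. Since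
`gaugedHam` commutes with permutations and `Λ(W ⊗ 𝔖)` consists of the antisymmetric elements of `W ⊗ 𝔖`
(`mem_map_antisymmetrizer`), invariance of the spaces of functions follows.

Smoothness comes from the differential equations of `ζ_i` and `E ∘ ζ_i`, and from the fact that
a principal power is smooth on each half-line. For the remaining claims, the map from spin
polynomials to functions on `U` is injective, since the points `ζ(x)` contain a product of infinite
sets, and `Λ (z^d |σ⟩)` is nonzero as soon as the one-particle states `(d_i, σ_i)` are pairwise
different (`coeff_antisymmetrizer_spinMonomial`).
-/

noncomputable section

namespace SpinCS

open MvPolynomial Filter Topology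

variable {N s : ℕ}

/-! ### Differential-difference operators on polynomials -/

/-- The operator `K_π` that permutes the coordinates, on scalar polynomials. -/
def renameEnd (π : Equiv.Perm (Fin N)) : Module.End ℂ (MvPolynomial (Fin N) ℂ) :=
  (rename π : MvPolynomial (Fin N) ℂ →ₐ[ℂ] MvPolynomial (Fin N) ℂ).toLinearMap

@[simp] theorem renameEnd_apply (π : Equiv.Perm (Fin N)) (f : MvPolynomial (Fin N) ℂ) :
    renameEnd π f = rename π f := rfl

theorem renameEnd_mul (π ρ : Equiv.Perm (Fin N)) :
    renameEnd π * renameEnd ρ = renameEnd (π * ρ) := by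
  refine LinearMap.ext fun f => ?_
  simp [rename_rename]

theorem X_sub_X_ne_zero {i j : Fin N} (h : i ≠ j) :
    (X i - X j : MvPolynomial (Fin N) ℂ) ≠ 0 :=
  sub_ne_zero.2 fun h' => h (X_injective h')

theorem X_sub_X_dvd (i j : Fin N) (f : MvPolynomial (Fin N) ℂ) :
    (X i - X j) ∣ f - rename (Equiv.swap i j) f := by
  induction f using MvPolynomial.induction_on with
  | C c => simp
  | add f g hf hg =>
    rw [map_add, add_sub_add_comm]
    exact dvd_add hf hg
  | mul_X f k hf =>
    have hk : (X i - X j : MvPolynomial (Fin N) ℂ) ∣ X k - X (Equiv.swap i j k) := by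
      rcases eq_or_ne k i with rfl | hi
      · simp
      rcases eq_or_ne k j with rfl | hj
      · rw [Equiv.swap_apply_right, ← neg_sub]
        exact ⟨-1, by ring⟩
      · simp [Equiv.swap_apply_of_ne_of_ne hi hj]
    have : f * X k - rename (Equiv.swap i j) (f * X k) =
        (f - rename (Equiv.swap i j) f) * X k +
          rename (Equiv.swap i j) f * (X k - X (Equiv.swap i j k)) := by
      simp only [map_mul, rename_X]
      ring
    rw [this]
    exact dvd_add (hf.mul_right _) (hk.mul_left _)

/-- The divided difference `(f - K_{ij} f) / (z_i - z_j)`, where `K_{ij}` exchanges `z_i` and `z_j`.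
For `i = j` it is set to `0`. -/
def divDiff (i j : Fin N) : Module.End ℂ (MvPolynomial (Fin N) ℂ) :=
  if h : i = j then 0 else
  { toFun := fun f => (X_sub_X_dvd i j f).choose
    map_add' := fun f g => by
      refine mul_left_cancel₀ (X_sub_X_ne_zero h) ?_
      rw [mul_add, ← (X_sub_X_dvd i j (f + g)).choose_spec, ← (X_sub_X_dvd i j f).choose_spec,
        ← (X_sub_X_dvd i j g).choose_spec, map_add, add_sub_add_comm]
    map_smul' := fun c f => by
      refine mul_left_cancel₀ (X_sub_X_ne_zero h) ?_
      rw [RingHom.id_apply, mul_smul_comm, ← (X_sub_X_dvd i j (c • f)).choose_spec,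
        ← (X_sub_X_dvd i j f).choose_spec, map_smul, smul_sub] }

theorem X_sub_X_mul_divDiff (i j : Fin N) (f : MvPolynomial (Fin N) ℂ) :
    (X i - X j) * divDiff i j f = f - rename (Equiv.swap i j) f := by
  by_cases h : i = j
  · subst h
    simp
  · rw [divDiff, dif_neg h]
    exact (X_sub_X_dvd i j f).choose_spec.symm

/-- The derivation `∂_i`. -/
def dMinus (i : Fin N) : Module.End ℂ (MvPolynomial (Fin N) ℂ) := (pderiv i).toLinearMap

/-- The operator `z_i ∂_i - m / 2`. -/
def dZero (m : ℕ) (i : Fin N) : Module.End ℂ (MvPolynomial (Fin N) ℂ) :=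
  LinearMap.mulLeft ℂ (X i) * (pderiv i).toLinearMap - ((m : ℂ) / 2) • 1

/-- The operator `z_i² ∂_i - m z_i`. It maps `z_i ^ l` to `(l - m) z_i ^ (l + 1)`, and so keeps a
degree in `z_i` that is at most `m` at most `m`. -/
def dPlus (m : ℕ) (i : Fin N) : Module.End ℂ (MvPolynomial (Fin N) ℂ) :=
  LinearMap.mulLeft ℂ (X i) * (LinearMap.mulLeft ℂ (X i) * (pderiv i).toLinearMap - (m : ℂ) • 1)

/-- The difference operator `(z_i + z_j) / 2 · (1 - K_{ij}) / (z_i - z_j)`. -/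
def aZero (i j : Fin N) : Module.End ℂ (MvPolynomial (Fin N) ℂ) :=
  (1 / 2 : ℂ) • (LinearMap.mulLeft ℂ (X i + X j) * divDiff i j)

/-- The difference operator `z_i z_j (1 - K_{ij}) / (z_i - z_j)`. -/
def aPlus (i j : Fin N) : Module.End ℂ (MvPolynomial (Fin N) ℂ) :=
  LinearMap.mulLeft ℂ (X i * X j) * divDiff i j

@[simp] theorem dMinus_apply (i : Fin N) (f : MvPolynomial (Fin N) ℂ) :
    dMinus i f = pderiv i f := rfl

@[simp] theorem dZero_apply (m : ℕ) (i : Fin N) (f : MvPolynomial (Fin N) ℂ) :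
    dZero m i f = X i * pderiv i f - ((m : ℂ) / 2) • f := rfl

@[simp] theorem dPlus_apply (m : ℕ) (i : Fin N) (f : MvPolynomial (Fin N) ℂ) :
    dPlus m i f = X i * (X i * pderiv i f - (m : ℂ) • f) := rfl

@[simp] theorem aZero_apply (i j : Fin N) (f : MvPolynomial (Fin N) ℂ) :
    aZero i j f = (1 / 2 : ℂ) • ((X i + X j) * divDiff i j f) := rfl

@[simp] theorem aPlus_apply (i j : Fin N) (f : MvPolynomial (Fin N) ℂ) :
    aPlus i j f = X i * X j * divDiff i j f := rfl

/-- The anticommutator `A B + B A`. -/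
def anticomm (A B : Module.End ℂ (MvPolynomial (Fin N) ℂ)) :
    Module.End ℂ (MvPolynomial (Fin N) ℂ) := A * B + B * A

/-- The part of the gauged Hamiltonian that acts on the particle `i` alone. As a differential
operator it is `P(z_i) ∂_i² + (Q(z_i) + (1 - m) P'(z_i) / 2) ∂_i` plus a quadratic polynomial in
`z_i`, see `oneBody_eval`. -/
def oneBody (p : Params) (i : Fin N) : Module.End ℂ (MvPolynomial (Fin N) ℂ) :=
  (p.cpp : ℂ) • (dPlus p.m i * dPlus p.m i)
    + ((p.c0p : ℂ) / 2) • anticomm (dPlus p.m i) (dZero p.m i)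
    + (p.c00 : ℂ) • (dZero p.m i * dZero p.m i)
    + ((p.c0m : ℂ) / 2) • anticomm (dZero p.m i) (dMinus i)
    + (p.cmm : ℂ) • (dMinus i * dMinus i)
    + (p.cp : ℂ) • dPlus p.m i + (p.c0 : ℂ) • dZero p.m i + (p.cm : ℂ) • dMinus i

/-- The interaction of the particles `i` and `j`: the part linear in `a` of the quadratic
combination of the Dunkl operators `D_i + a A_{ij}` and `D_j + a A_{ji}`. It is symmetric in `i`
and `j`. -/
def twoBody (p : Params) (i j : Fin N) : Module.End ℂ (MvPolynomial (Fin N) ℂ) :=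
  (p.cpp : ℂ) • anticomm (dPlus p.m i - dPlus p.m j) (aPlus i j)
    + ((p.c0p : ℂ) / 2) • (anticomm (dPlus p.m i - dPlus p.m j) (aZero i j)
        + anticomm (dZero p.m i - dZero p.m j) (aPlus i j))
    + (p.c00 : ℂ) • anticomm (dZero p.m i - dZero p.m j) (aZero i j)
    + ((p.c0m : ℂ) / 2) • (anticomm (dZero p.m i - dZero p.m j) (divDiff i j)
        + anticomm (dMinus i - dMinus j) (aZero i j))
    + (p.cmm : ℂ) • anticomm (dMinus i - dMinus j) (divDiff i j)

/-- The polynomial operator that is gauge equivalent to `-H` on antisymmetric spin polynomials, once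
`S_{ij}` is replaced by `-K_{ij}`. -/
def gaugedHam (N : ℕ) (p : Params) : Module.End ℂ (MvPolynomial (Fin N) ℂ) :=
  ∑ i, oneBody p i
    + ((p.a : ℂ) / 2) • ∑ i, ∑ j with j ≠ i, twoBody p i j
    + ((p.a : ℂ) ^ 2 / 12 * p.c00) • ∑ i, ∑ j with j ≠ i, ∑ k with k ≠ i ∧ k ≠ j,
        (1 - renameEnd (Equiv.swap i k) * renameEnd (Equiv.swap i j))

/-! ### Permutation equivariance -/

theorem rename_divDiff (π : Equiv.Perm (Fin N)) (i j : Fin N) (f : MvPolynomial (Fin N) ℂ) :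
    rename π (divDiff i j f) = divDiff (π i) (π j) (rename π f) := by
  by_cases h : i = j
  · simp [divDiff, h]
  · refine mul_left_cancel₀ (X_sub_X_ne_zero (π.injective.ne h)) ?_
    have h1 := congrArg (rename π) (X_sub_X_mul_divDiff i j f)
    rw [map_mul, map_sub, rename_X, rename_X, map_sub, rename_rename] at h1
    rw [h1, X_sub_X_mul_divDiff, rename_rename]
    congr 3
    funext k
    simp [Equiv.swap_apply_def]
    split_ifs <;> simp_all

theorem rename_pderiv (π : Equiv.Perm (Fin N)) (i : Fin N) (f : MvPolynomial (Fin N) ℂ) :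
    rename π (pderiv i f) = pderiv (π i) (rename π f) := by
  induction f using MvPolynomial.induction_on with
  | C c => simp
  | add f g hf hg => simp [hf, hg]
  | mul_X f k hf =>
    by_cases hk : k = i
    · subst hk
      simp [Derivation.leibniz, hf]
    · simp [Derivation.leibniz, hf, pderiv_X_of_ne hk, pderiv_X_of_ne (π.injective.ne hk)]

theorem semiconj_dMinus (π : Equiv.Perm (Fin N)) (i : Fin N) :
    SemiconjBy (renameEnd π) (dMinus i) (dMinus (π i)) :=
  LinearMap.ext fun f => by simp [rename_pderiv]

theorem semiconj_dZero (m : ℕ) (π : Equiv.Perm (Fin N)) (i : Fin N) :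
    SemiconjBy (renameEnd π) (dZero m i) (dZero m (π i)) :=
  LinearMap.ext fun f => by simp [rename_pderiv]

theorem semiconj_dPlus (m : ℕ) (π : Equiv.Perm (Fin N)) (i : Fin N) :
    SemiconjBy (renameEnd π) (dPlus m i) (dPlus m (π i)) :=
  LinearMap.ext fun f => by simp [rename_pderiv]

theorem semiconj_divDiff (π : Equiv.Perm (Fin N)) (i j : Fin N) :
    SemiconjBy (renameEnd π) (divDiff i j) (divDiff (π i) (π j)) :=
  LinearMap.ext fun f => by simp [rename_divDiff]

theorem semiconj_aZero (π : Equiv.Perm (Fin N)) (i j : Fin N) :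
    SemiconjBy (renameEnd π) (aZero i j) (aZero (π i) (π j)) :=
  LinearMap.ext fun f => by simp [rename_divDiff]

theorem semiconj_aPlus (π : Equiv.Perm (Fin N)) (i j : Fin N) :
    SemiconjBy (renameEnd π) (aPlus i j) (aPlus (π i) (π j)) :=
  LinearMap.ext fun f => by simp [rename_divDiff]

theorem semiconj_smul {K A B : Module.End ℂ (MvPolynomial (Fin N) ℂ)} (c : ℂ)
    (h : SemiconjBy K A B) : SemiconjBy K (c • A) (c • B) := by
  rw [SemiconjBy, mul_smul_comm, h.eq, smul_mul_assoc]

theorem semiconj_anticomm {K A A' B B' : Module.End ℂ (MvPolynomial (Fin N) ℂ)}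
    (hA : SemiconjBy K A A') (hB : SemiconjBy K B B') :
    SemiconjBy K (anticomm A B) (anticomm A' B') :=
  (hA.mul_right hB).add_right (hB.mul_right hA)

theorem semiconj_oneBody (p : Params) (π : Equiv.Perm (Fin N)) (i : Fin N) :
    SemiconjBy (renameEnd π) (oneBody p i) (oneBody p (π i)) := by
  have hp := semiconj_dPlus p.m π i
  have h0 := semiconj_dZero p.m π i
  have hm := semiconj_dMinus π i
  exact (((((((semiconj_smul _ (hp.mul_right hp)).add_right
    (semiconj_smul _ (semiconj_anticomm hp h0))).add_right
    (semiconj_smul _ (h0.mul_right h0))).add_right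
    (semiconj_smul _ (semiconj_anticomm h0 hm))).add_right
    (semiconj_smul _ (hm.mul_right hm))).add_right
    (semiconj_smul _ hp)).add_right (semiconj_smul _ h0)).add_right (semiconj_smul _ hm)

theorem semiconj_twoBody (p : Params) (π : Equiv.Perm (Fin N)) (i j : Fin N) :
    SemiconjBy (renameEnd π) (twoBody p i j) (twoBody p (π i) (π j)) := by
  have hp := (semiconj_dPlus p.m π i).sub_right (semiconj_dPlus p.m π j)
  have h0 := (semiconj_dZero p.m π i).sub_right (semiconj_dZero p.m π j)
  have hm := (semiconj_dMinus π i).sub_right (semiconj_dMinus π j)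
  have ap := semiconj_aPlus π i j
  have a0 := semiconj_aZero π i j
  have am := semiconj_divDiff π i j
  exact ((((semiconj_smul _ (semiconj_anticomm hp ap)).add_right
    (semiconj_smul _ ((semiconj_anticomm hp a0).add_right (semiconj_anticomm h0 ap)))).add_right
    (semiconj_smul _ (semiconj_anticomm h0 a0))).add_right
    (semiconj_smul _ ((semiconj_anticomm h0 am).add_right (semiconj_anticomm hm a0)))).add_right
    (semiconj_smul _ (semiconj_anticomm hm am))

theorem semiconj_swap (π : Equiv.Perm (Fin N)) (i j : Fin N) :
    SemiconjBy (renameEnd π) (renameEnd (Equiv.swap i j))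
      (renameEnd (Equiv.swap (π i) (π j))) := by
  rw [SemiconjBy, renameEnd_mul, renameEnd_mul]
  congr 1
  ext k
  simp [Equiv.swap_apply_def]
  split_ifs <;> simp_all

/-- Relabelling the particles in a sum over one index. -/
theorem semiconj_sum {ι : Type*} {K : Module.End ℂ (MvPolynomial (Fin N) ℂ)}
    {s t : Finset ι} {A B : ι → Module.End ℂ (MvPolynomial (Fin N) ℂ)} (e : ι ≃ ι)
    (hst : ∀ i, i ∈ s ↔ e i ∈ t) (h : ∀ i, SemiconjBy K (A i) (B (e i))) :
    SemiconjBy K (∑ i ∈ s, A i) (∑ i ∈ t, B i) := by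
  rw [SemiconjBy, Finset.mul_sum, Finset.sum_mul]
  exact Finset.sum_equiv e hst fun i _ => (h i).eq

/-- The gauged Hamiltonian treats all particles alike. -/
theorem commute_gaugedHam (p : Params) (π : Equiv.Perm (Fin N)) :
    Commute (renameEnd π) (gaugedHam N p) := by
  refine ((semiconj_sum π (by simp) fun i => semiconj_oneBody p π i).add_right
    (semiconj_smul _ (semiconj_sum π (by simp) fun i => semiconj_sum π (by simp)
      fun j => semiconj_twoBody p π i j))).add_right
    (semiconj_smul _ (semiconj_sum π (by simp) fun i => semiconj_sum π (by simp)
      fun j => semiconj_sum π (by simp) fun k => ?_))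
  exact (SemiconjBy.one_right _).sub_right
    ((semiconj_swap π i k).mul_right (semiconj_swap π i j))

/-! ### Invariant polynomial modules -/

/-- The algebra of the operators that map the space `W` to itself. -/
def stabilizer (W : Submodule ℂ (MvPolynomial (Fin N) ℂ)) :
    Subalgebra ℂ (Module.End ℂ (MvPolynomial (Fin N) ℂ)) where
  carrier := {T | ∀ f ∈ W, T f ∈ W}
  mul_mem' hA hB f hf := hA _ (hB f hf)
  add_mem' hA hB f hf := W.add_mem (hA f hf) (hB f hf)
  algebraMap_mem' c f hf := by
    rw [Module.algebraMap_end_apply]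
    exact W.smul_mem c hf

theorem anticomm_mem_stabilizer {W : Submodule ℂ (MvPolynomial (Fin N) ℂ)}
    {A B : Module.End ℂ (MvPolynomial (Fin N) ℂ)}
    (hA : A ∈ stabilizer W) (hB : B ∈ stabilizer W) : anticomm A B ∈ stabilizer W :=
  add_mem (mul_mem hA hB) (mul_mem hB hA)

/-- Stability of `W` is checked on the generators; the operators that raise the degree matter only
if one of the coefficients `c_{++}, c_{0+}, c_+` in front of them is nonzero. -/
theorem gaugedHam_mem_stabilizer {W : Submodule ℂ (MvPolynomial (Fin N) ℂ)} (p : Params)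
    (hK : ∀ π, renameEnd π ∈ stabilizer W)
    (hdm : ∀ i, dMinus i ∈ stabilizer W) (hd0 : ∀ i, dZero p.m i ∈ stabilizer W)
    (ham : ∀ i j, divDiff i j ∈ stabilizer W) (ha0 : ∀ i j, aZero i j ∈ stabilizer W)
    (hplus : (p.cpp = 0 ∧ p.c0p = 0 ∧ p.cp = 0) ∨
      ((∀ i, dPlus p.m i ∈ stabilizer W) ∧ ∀ i j, aPlus i j ∈ stabilizer W)) :
    gaugedHam N p ∈ stabilizer W := by
  refine add_mem (add_mem (sum_mem fun i _ => ?_) (Subalgebra.smul_mem _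
    (sum_mem fun i _ => sum_mem fun j _ => ?_) _))
    (Subalgebra.smul_mem _ (sum_mem fun i _ => sum_mem fun j _ => sum_mem fun k _ =>
      sub_mem (one_mem _) (mul_mem (hK _) (hK _))) _)
  · have h1 : (p.c00 : ℂ) • (dZero p.m i * dZero p.m i)
        + ((p.c0m : ℂ) / 2) • anticomm (dZero p.m i) (dMinus i)
        + (p.cmm : ℂ) • (dMinus i * dMinus i) ∈ stabilizer W :=
      add_mem (add_mem (Subalgebra.smul_mem _ (mul_mem (hd0 i) (hd0 i)) _)
        (Subalgebra.smul_mem _ (anticomm_mem_stabilizer (hd0 i) (hdm i)) _))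
        (Subalgebra.smul_mem _ (mul_mem (hdm i) (hdm i)) _)
    have h2 : (p.c0 : ℂ) • dZero p.m i + (p.cm : ℂ) • dMinus i ∈ stabilizer W :=
      add_mem (Subalgebra.smul_mem _ (hd0 i) _) (Subalgebra.smul_mem _ (hdm i) _)
    have h3 : (p.cpp : ℂ) • (dPlus p.m i * dPlus p.m i)
        + ((p.c0p : ℂ) / 2) • anticomm (dPlus p.m i) (dZero p.m i)
        + (p.cp : ℂ) • dPlus p.m i ∈ stabilizer W := by
      rcases hplus with ⟨e1, e2, e3⟩ | ⟨hdp, -⟩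
      · simp [e1, e2, e3, zero_mem]
      · exact add_mem (add_mem (Subalgebra.smul_mem _ (mul_mem (hdp i) (hdp i)) _)
          (Subalgebra.smul_mem _ (anticomm_mem_stabilizer (hdp i) (hd0 i)) _))
          (Subalgebra.smul_mem _ (hdp i) _)
    convert add_mem (add_mem h1 h2) h3 using 1
    rw [oneBody]
    abel
  · have h1 : (p.c00 : ℂ) • anticomm (dZero p.m i - dZero p.m j) (aZero i j)
        + ((p.c0m : ℂ) / 2) • (anticomm (dZero p.m i - dZero p.m j) (divDiff i j)
            + anticomm (dMinus i - dMinus j) (aZero i j))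
        + (p.cmm : ℂ) • anticomm (dMinus i - dMinus j) (divDiff i j) ∈ stabilizer W := by
      have d0 := sub_mem (hd0 i) (hd0 j)
      have dm := sub_mem (hdm i) (hdm j)
      exact add_mem (add_mem (Subalgebra.smul_mem _ (anticomm_mem_stabilizer d0 (ha0 i j)) _)
        (Subalgebra.smul_mem _ (add_mem (anticomm_mem_stabilizer d0 (ham i j))
          (anticomm_mem_stabilizer dm (ha0 i j))) _))
        (Subalgebra.smul_mem _ (anticomm_mem_stabilizer dm (ham i j)) _)
    have h2 : (p.cpp : ℂ) • anticomm (dPlus p.m i - dPlus p.m j) (aPlus i j)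
        + ((p.c0p : ℂ) / 2) • (anticomm (dPlus p.m i - dPlus p.m j) (aZero i j)
            + anticomm (dZero p.m i - dZero p.m j) (aPlus i j)) ∈ stabilizer W := by
      rcases hplus with ⟨e1, e2, -⟩ | ⟨hdp, hap⟩
      · simp [e1, e2, zero_mem]
      · have d0 := sub_mem (hd0 i) (hd0 j)
        have dp := sub_mem (hdp i) (hdp j)
        exact add_mem (Subalgebra.smul_mem _ (anticomm_mem_stabilizer dp (hap i j)) _)
          (Subalgebra.smul_mem _ (add_mem (anticomm_mem_stabilizer dp (ha0 i j))
            (anticomm_mem_stabilizer d0 (hap i j))) _)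
    convert add_mem h1 h2 using 1
    rw [twoBody]
    abel

theorem mem_stabilizer_restrictSupport {S : Set (Fin N →₀ ℕ)}
    {T : Module.End ℂ (MvPolynomial (Fin N) ℂ)}
    (h : ∀ d ∈ S, T (monomial d 1) ∈ restrictSupport ℂ S) :
    T ∈ stabilizer (restrictSupport ℂ S) := by
  have : restrictSupport ℂ S ≤ (restrictSupport ℂ S).comap T := by
    conv_lhs => rw [restrictSupport_eq_span]
    rw [Submodule.span_le]
    rintro _ ⟨d, hd, rfl⟩
    exact h d hd
  exact this

theorem renameEnd_mem_stabilizer_rect (n : ℕ) (π : Equiv.Perm (Fin N)) :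
    renameEnd π ∈ stabilizer (rectModule N n) := by
  refine mem_stabilizer_restrictSupport fun d hd => ?_
  rw [renameEnd_apply, rename_monomial, monomial_mem_restrictSupport]
  refine Or.inl fun i => ?_
  rw [← π.apply_symm_apply i, Finsupp.mapDomain_apply π.injective]
  exact hd _

theorem renameEnd_mem_stabilizer_tri (n : ℕ) (π : Equiv.Perm (Fin N)) :
    renameEnd π ∈ stabilizer (triModule N n) := fun f hf => by
  rw [triModule, mem_restrictTotalDegree] at hf ⊢
  exact (totalDegree_rename_le _ _).trans hf

theorem dMinus_mem_stabilizer_rect (n : ℕ) (i : Fin N) :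
    dMinus i ∈ stabilizer (rectModule N n) := by
  refine mem_stabilizer_restrictSupport fun d hd => ?_
  rw [dMinus_apply, pderiv_monomial, monomial_mem_restrictSupport]
  exact Or.inl fun k => le_trans (by simp) (hd k)

theorem dMinus_mem_stabilizer_tri (n : ℕ) (i : Fin N) :
    dMinus i ∈ stabilizer (triModule N n) := by
  refine mem_stabilizer_restrictSupport fun d hd => ?_
  rw [dMinus_apply, pderiv_monomial, monomial_mem_restrictSupport]
  exact Or.inl (le_trans (Finsupp.degree_mono (a := d - Finsupp.single i 1) tsub_le_self) hd)

theorem dZero_mem_stabilizer (m : ℕ) (S : Set (Fin N →₀ ℕ)) (i : Fin N) :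
    dZero m i ∈ stabilizer (restrictSupport ℂ S) := by
  refine mem_stabilizer_restrictSupport fun d hd => ?_
  have hd' : monomial d (1 : ℂ) ∈ restrictSupport ℂ S :=
    (monomial_mem_restrictSupport ℂ).2 (Or.inl hd)
  rw [dZero_apply, X_mul_pderiv_monomial]
  exact sub_mem (nsmul_mem hd' _) (Submodule.smul_mem _ _ hd')

theorem dPlus_mem_stabilizer_rect (m : ℕ) (i : Fin N) :
    dPlus m i ∈ stabilizer (rectModule N m) := by
  refine mem_stabilizer_restrictSupport fun d hd => ?_
  rw [dPlus_apply, X_mul_pderiv_monomial, ← Nat.cast_smul_eq_nsmul ℂ, ← sub_smul, mul_smul_comm,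
    mul_comm, X, monomial_mul, smul_monomial, monomial_mem_restrictSupport]
  -- The factor `d i - m` vanishes exactly when multiplication by `z_i` would leave the module.
  rcases (hd i).lt_or_eq with h | h
  · refine Or.inl fun k => ?_
    rcases eq_or_ne k i with rfl | hk
    · simpa using h
    · simpa [hk.symm] using hd k
  · simp [h]

/-- The degree in `z_i` and in `z_j` drops by one upon division by `z_i - z_j`. -/
theorem divDiff_eq_zero_or {n : ℕ} {i j : Fin N} {f : MvPolynomial (Fin N) ℂ}
    (hf : f ∈ rectModule N n) : divDiff i j f = 0 ∨
      (∀ k, degreeOf k (divDiff i j f) ≤ n) ∧ degreeOf i (divDiff i j f) + 1 ≤ n ∧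
        degreeOf j (divDiff i j f) + 1 ≤ n := by
  by_cases h : i = j
  · simp [divDiff, h]
  refine or_iff_not_imp_left.2 fun h0 => ?_
  have hg : (X i - X j) * divDiff i j f ∈ rectModule N n := by
    rw [X_sub_X_mul_divDiff]
    exact sub_mem hf (renameEnd_mem_stabilizer_rect n _ f hf)
  rw [rectModule, mem_restrictDegree] at hg
  have hk : ∀ k, degreeOf k (X i - X j : MvPolynomial (Fin N) ℂ) +
      degreeOf k (divDiff i j f) ≤ n := fun k => by
    rw [← degreeOf_mul_eq (X_sub_X_ne_zero h) h0]
    exact degreeOf_le_iff.2 fun d hd => hg d hd k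
  have hpos : ∀ k, coeff (Finsupp.single k 1) (X i - X j : MvPolynomial (Fin N) ℂ) ≠ 0 →
      1 ≤ degreeOf k (X i - X j : MvPolynomial (Fin N) ℂ) := fun k hk => by
    simpa using degreeOf_le_iff.1 (le_refl (degreeOf k _)) (Finsupp.single k 1)
      (mem_support_iff.2 hk)
  have hi := hpos i (by simp [coeff_X, Finsupp.single_left_inj, Ne.symm h])
  have hj := hpos j (by simp [coeff_X, Finsupp.single_left_inj, h])
  exact ⟨fun k => le_trans le_add_self (hk k), by have := hk i; omega, by have := hk j; omega⟩

theorem mem_rectModule_iff {n : ℕ} {f : MvPolynomial (Fin N) ℂ} :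
    f ∈ rectModule N n ↔ ∀ k, degreeOf k f ≤ n := by
  rw [rectModule, mem_restrictDegree]
  exact ⟨fun h k => degreeOf_le_iff.2 fun d hd => h d hd k,
    fun h d hd k => degreeOf_le_iff.1 (h k) d hd⟩

theorem divDiff_mem_stabilizer_rect (n : ℕ) (i j : Fin N) :
    divDiff i j ∈ stabilizer (rectModule N n) := fun f hf => by
  rcases divDiff_eq_zero_or (i := i) (j := j) hf with h | h
  · rw [h]
    exact zero_mem _
  · exact mem_rectModule_iff.2 h.1

/-- Multiplication by `z_i` or `z_j` makes up for the degree that `f - K_{ij} f` loses upon division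
by `z_i - z_j`. -/
theorem X_mul_divDiff_mem {n : ℕ} {i j l : Fin N} (hl : l = i ∨ l = j)
    {f : MvPolynomial (Fin N) ℂ} (hf : f ∈ rectModule N n) :
    X l * divDiff i j f ∈ rectModule N n := by
  rcases divDiff_eq_zero_or (i := i) (j := j) hf with h | ⟨h, h'⟩
  · rw [h, mul_zero]
    exact zero_mem _
  · refine mem_rectModule_iff.2 fun k => (degreeOf_mul_le _ _ _).trans ?_
    rw [degreeOf_X]
    split_ifs with hk
    · subst hk
      rcases hl with rfl | rfl <;> omega
    · simpa using h k

theorem aZero_mem_stabilizer_rect (n : ℕ) (i j : Fin N) :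
    aZero i j ∈ stabilizer (rectModule N n) := fun f hf => by
  rw [aZero_apply, add_mul]
  exact Submodule.smul_mem _ _ (add_mem (X_mul_divDiff_mem (Or.inl rfl) hf)
    (X_mul_divDiff_mem (Or.inr rfl) hf))

theorem aPlus_mem_stabilizer_rect (n : ℕ) (i j : Fin N) :
    aPlus i j ∈ stabilizer (rectModule N n) := fun f hf => by
  rw [aPlus_apply]
  by_cases hij : i = j
  · simp [divDiff, hij, zero_mem]
  rcases divDiff_eq_zero_or (i := i) (j := j) hf with h | ⟨h, h'⟩
  · rw [h, mul_zero]
    exact zero_mem _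
  · refine mem_rectModule_iff.2 fun k => (degreeOf_mul_le _ _ _).trans ?_
    have hX := degreeOf_mul_le k (X i) (X j : MvPolynomial (Fin N) ℂ)
    rw [degreeOf_X, degreeOf_X] at hX
    have hk := h k
    split_ifs at hX with h1 h2 h2
    · exact absurd (h1.symm.trans h2) hij
    · subst h1
      omega
    · subst h2
      omega
    · omega

theorem divDiff_totalDegree {n : ℕ} {i j : Fin N} {f : MvPolynomial (Fin N) ℂ}
    (hf : f ∈ triModule N n) : divDiff i j f = 0 ∨ totalDegree (divDiff i j f) + 1 ≤ n := by
  by_cases h : i = j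
  · simp [divDiff, h]
  refine or_iff_not_imp_left.2 fun h0 => ?_
  have hg : (X i - X j) * divDiff i j f ∈ triModule N n := by
    rw [X_sub_X_mul_divDiff]
    exact sub_mem hf (renameEnd_mem_stabilizer_tri n _ f hf)
  rw [triModule, mem_restrictTotalDegree, totalDegree_mul_of_isDomain (X_sub_X_ne_zero h) h0] at hg
  have h1 : 1 ≤ totalDegree (X i - X j : MvPolynomial (Fin N) ℂ) := by
    have := le_totalDegree (p := (X i - X j : MvPolynomial (Fin N) ℂ)) (s := Finsupp.single i 1)
      (mem_support_iff.2 (by simp [coeff_X, Finsupp.single_left_inj, Ne.symm h]))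
    simpa using this
  omega

theorem divDiff_mem_stabilizer_tri (n : ℕ) (i j : Fin N) :
    divDiff i j ∈ stabilizer (triModule N n) := fun f hf => by
  rcases divDiff_totalDegree (i := i) (j := j) hf with h | h
  · rw [h]
    exact zero_mem _
  · rw [triModule, mem_restrictTotalDegree]
    omega

theorem aZero_mem_stabilizer_tri (n : ℕ) (i j : Fin N) :
    aZero i j ∈ stabilizer (triModule N n) := fun f hf => by
  have key : ∀ l : Fin N, X l * divDiff i j f ∈ triModule N n := fun l => by
    rcases divDiff_totalDegree (i := i) (j := j) hf with h | h
    · rw [h, mul_zero]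
      exact zero_mem _
    · rw [triModule, mem_restrictTotalDegree]
      refine (totalDegree_mul _ _).trans ?_
      rw [totalDegree_X]
      omega
  rw [aZero_apply, add_mul]
  exact Submodule.smul_mem _ _ (add_mem (key i) (key j))

theorem gaugedHam_rect (p : Params) : gaugedHam N p ∈ stabilizer (rectModule N p.m) :=
  gaugedHam_mem_stabilizer p (renameEnd_mem_stabilizer_rect _) (dMinus_mem_stabilizer_rect _)
    (dZero_mem_stabilizer _ _) (divDiff_mem_stabilizer_rect _) (aZero_mem_stabilizer_rect _)
    (Or.inr ⟨dPlus_mem_stabilizer_rect _, aPlus_mem_stabilizer_rect _⟩)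

theorem gaugedHam_rect_of_eq_zero (p : Params) (h : p.cpp = 0 ∧ p.c0p = 0 ∧ p.cp = 0) (n : ℕ) :
    gaugedHam N p ∈ stabilizer (rectModule N n) :=
  gaugedHam_mem_stabilizer p (renameEnd_mem_stabilizer_rect _) (dMinus_mem_stabilizer_rect _)
    (dZero_mem_stabilizer _ _) (divDiff_mem_stabilizer_rect _) (aZero_mem_stabilizer_rect _)
    (Or.inl h)

theorem gaugedHam_tri_of_eq_zero (p : Params) (h : p.cpp = 0 ∧ p.c0p = 0 ∧ p.cp = 0) (n : ℕ) :
    gaugedHam N p ∈ stabilizer (triModule N n) :=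
  gaugedHam_mem_stabilizer p (renameEnd_mem_stabilizer_tri _) (dMinus_mem_stabilizer_tri _)
    (dZero_mem_stabilizer _ _) (divDiff_mem_stabilizer_tri _) (aZero_mem_stabilizer_tri _)
    (Or.inl h)

/-! ### Antisymmetric spin polynomials -/

/-- Invariance up to the sign under simultaneous permutations of coordinates and spins. -/
def IsAntisymm {s : ℕ} (Φ : SpinPoly N s) : Prop :=
  ∀ (π : Equiv.Perm (Fin N)) (σ : Config N s),
    rename π (Φ (σ ∘ π)) = ((Equiv.Perm.sign π : ℤ) : ℂ) • Φ σ

theorem antisymmetrizer_apply (F : SpinPoly N s) (σ : Config N s) :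
    antisymmetrizer N s F σ =
      ∑ π : Equiv.Perm (Fin N), ((Equiv.Perm.sign π : ℤ) : ℂ) • rename π (F (σ ∘ π)) := by
  rw [antisymmetrizer, LinearMap.sum_apply, Finset.sum_apply]
  rfl

theorem isAntisymm_antisymmetrizer (F : SpinPoly N s) : IsAntisymm (antisymmetrizer N s F) := by
  intro π σ
  rw [antisymmetrizer_apply, antisymmetrizer_apply, map_sum, Finset.smul_sum]
  refine Fintype.sum_equiv (Equiv.mulLeft π) _ _ fun ρ => ?_
  rw [map_smul, rename_rename, smul_smul, Equiv.coe_mulLeft, Equiv.Perm.sign_mul,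
    ← Equiv.Perm.coe_mul, Function.comp_assoc, ← Equiv.Perm.coe_mul]
  congr 1
  rcases Int.units_eq_one_or (Equiv.Perm.sign π) with h | h <;> simp [h]

theorem IsAntisymm.antisymmetrizer_eq {Φ : SpinPoly N s} (h : IsAntisymm Φ) :
    antisymmetrizer N s Φ = (N.factorial : ℂ) • Φ := by
  funext σ
  rw [antisymmetrizer_apply, Finset.sum_congr rfl fun π _ => by rw [h π σ, smul_smul]]
  have : ∀ π : Equiv.Perm (Fin N),
      ((Equiv.Perm.sign π : ℤ) : ℂ) * ((Equiv.Perm.sign π : ℤ) : ℂ) = 1 := fun π => by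
    rcases Int.units_eq_one_or (Equiv.Perm.sign π) with h | h <;> simp [h]
  simp [this, Fintype.card_perm, ← Nat.cast_smul_eq_nsmul ℂ]

/-- `Λ(W ⊗ 𝔖)` consists of the antisymmetric elements of `W ⊗ 𝔖`. -/
theorem mem_map_antisymmetrizer {W : Submodule ℂ (MvPolynomial (Fin N) ℂ)}
    (hW : ∀ π, renameEnd π ∈ stabilizer W) {Φ : SpinPoly N s} :
    Φ ∈ (tensorSpin s W).map (antisymmetrizer N s) ↔ IsAntisymm Φ ∧ ∀ σ, Φ σ ∈ W := by
  constructor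
  · rintro ⟨F, hF, rfl⟩
    refine ⟨isAntisymm_antisymmetrizer F, fun σ => ?_⟩
    rw [antisymmetrizer_apply]
    exact sum_mem fun π _ => W.smul_mem _ (hW π _ (hF _ trivial))
  · rintro ⟨h, hΦ⟩
    refine ⟨(N.factorial : ℂ)⁻¹ • Φ, fun σ _ => W.smul_mem _ (hΦ σ), ?_⟩
    rw [map_smul, h.antisymmetrizer_eq, smul_smul, inv_mul_cancel₀ (by
      exact_mod_cast N.factorial_ne_zero), one_smul]

theorem IsAntisymm.map {Φ : SpinPoly N s} (h : IsAntisymm Φ)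
    {T : Module.End ℂ (MvPolynomial (Fin N) ℂ)} (hT : ∀ π, Commute (renameEnd π) T) :
    IsAntisymm fun σ => T (Φ σ) := fun π σ => by
  have := LinearMap.congr_fun (hT π).eq (Φ (σ ∘ π))
  simp only [Module.End.mul_apply, renameEnd_apply] at this
  rw [this, h π σ, map_smul]

/-- The spin exchange acts on antisymmetric spin polynomials as minus the coordinate exchange. -/
theorem IsAntisymm.comp_swap {Φ : SpinPoly N s} (h : IsAntisymm Φ) {i j : Fin N} (hij : i ≠ j)
    (σ : Config N s) : Φ (σ ∘ Equiv.swap i j) = -rename (Equiv.swap i j) (Φ σ) := by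
  have := h (Equiv.swap i j) (σ ∘ Equiv.swap i j)
  rw [Function.comp_assoc, ← Equiv.Perm.coe_mul, Equiv.swap_mul_self, Equiv.Perm.coe_one,
    Function.comp_id, Equiv.Perm.sign_swap hij] at this
  rw [this]
  simp

/-! ### Values at a point with distinct coordinates -/

theorem oneBody_eval (p : Params) (i : Fin N) (z : Fin N → ℝ) (f : MvPolynomial (Fin N) ℂ) :
    eval (fun l => (z l : ℂ)) (oneBody p i f) =
      (((polyP p).eval (z i) : ℝ) : ℂ) * eval (fun l => (z l : ℂ)) (pderiv i (pderiv i f))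
      + ((polyQ p).eval (z i) + (1 - p.m) / 2 * (polyP p).derivative.eval (z i) : ℝ)
        * eval (fun l => (z l : ℂ)) (pderiv i f)
      + (p.cpp * (p.m * (p.m - 1)) * z i ^ 2
          + (p.c0p * (p.m * (p.m - 1) / 2) - p.m * p.cp) * z i
          + (p.c00 * p.m ^ 2 / 4 - p.m / 2 * p.c0) : ℝ) * eval (fun l => (z l : ℂ)) f := by
  simp only [oneBody, anticomm, LinearMap.add_apply, LinearMap.smul_apply, Module.End.mul_apply,
    dMinus_apply, dZero_apply, dPlus_apply, map_add, map_sub, smul_eval, map_mul, eval_X,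
    Derivation.leibniz, Derivation.map_smul, pderiv_X_self, smul_eq_mul, polyP, polyQ,
    Polynomial.eval_add, Polynomial.eval_mul, Polynomial.eval_C, Polynomial.eval_pow,
    Polynomial.eval_X, Polynomial.derivative_mul,
    Polynomial.derivative_C, Polynomial.derivative_X, Polynomial.derivative_X_pow,
    Polynomial.eval_zero, Polynomial.eval_one, map_one]
  push_cast
  ring

theorem rename_swap_pderiv (i j : Fin N) (f : MvPolynomial (Fin N) ℂ) :
    rename (Equiv.swap i j) (pderiv i f) = pderiv j (rename (Equiv.swap i j) f) := by
  simpa using rename_pderiv (Equiv.swap i j) i f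

theorem rename_swap_pderiv' (i j : Fin N) (f : MvPolynomial (Fin N) ℂ) :
    rename (Equiv.swap i j) (pderiv j f) = pderiv i (rename (Equiv.swap i j) f) := by
  simpa using rename_pderiv (Equiv.swap i j) j f

section

variable {i j : Fin N} (w : Fin N → ℂ) (f : MvPolynomial (Fin N) ℂ)

theorem eval_divDiff (hw : w i ≠ w j) :
    eval w (divDiff i j f) =
      (eval w f - eval w (rename (Equiv.swap i j) f)) / (w i - w j) := by
  have h := congrArg (eval w) (X_sub_X_mul_divDiff i j f)
  simp only [map_mul, map_sub, eval_X] at h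
  rw [eq_div_iff (sub_ne_zero.2 hw), mul_comm, h]

theorem eval_pderiv_divDiff_left (hw : w i ≠ w j) :
    eval w (pderiv i (divDiff i j f)) =
      (eval w (pderiv i f) - eval w (pderiv i (rename (Equiv.swap i j) f))
        - eval w (divDiff i j f)) / (w i - w j) := by
  have hij : j ≠ i := by
    rintro rfl
    exact hw rfl
  have h := congrArg (fun q => eval w (pderiv i q)) (X_sub_X_mul_divDiff i j f)
  simp only [Derivation.leibniz, map_sub, map_add, pderiv_X_self, pderiv_X_of_ne hij, smul_eq_mul,
    map_mul, eval_X, map_one, map_zero] at h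
  rw [eq_div_iff (sub_ne_zero.2 hw)]
  linear_combination h

theorem eval_pderiv_divDiff_right (hw : w i ≠ w j) :
    eval w (pderiv j (divDiff i j f)) =
      (eval w (pderiv j f) - eval w (pderiv j (rename (Equiv.swap i j) f))
        + eval w (divDiff i j f)) / (w i - w j) := by
  have hij : i ≠ j := by
    rintro rfl
    exact hw rfl
  have h := congrArg (fun q => eval w (pderiv j q)) (X_sub_X_mul_divDiff i j f)
  simp only [Derivation.leibniz, map_sub, map_add, pderiv_X_self, pderiv_X_of_ne hij, smul_eq_mul,
    map_mul, eval_X, map_one, map_zero] at h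
  rw [eq_div_iff (sub_ne_zero.2 hw)]
  linear_combination h

end

/-- At a point with `z_i ≠ z_j`, the interaction in terms of the values and first derivatives of `f`
at that point and of the value of `K_{ij} f`. -/
theorem twoBody_eval (p : Params) {i j : Fin N} (z : Fin N → ℝ) (hz : z i ≠ z j)
    (f : MvPolynomial (Fin N) ℂ) :
    eval (fun l => (z l : ℂ)) (twoBody p i j f) =
      2 * ((((polyP p).eval (z i) : ℝ) : ℂ) * eval (fun l => (z l : ℂ)) (pderiv i f)
        - (((polyP p).eval (z j) : ℝ) : ℂ) * eval (fun l => (z l : ℂ)) (pderiv j f)) / (z i - z j)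
      - ((((polyP p).eval (z i) : ℝ) : ℂ) + (((polyP p).eval (z j) : ℝ) : ℂ)) / (z i - z j) ^ 2
        * (eval (fun l => (z l : ℂ)) f
          - eval (fun l => (z l : ℂ)) (rename (Equiv.swap i j) f))
      - 1 / 2 *
        ((((polyP p).derivative.eval (z i) : ℝ) : ℂ) * eval (fun l => (z l : ℂ)) (pderiv i f)
        + (((polyP p).derivative.eval (z j) : ℝ) : ℂ) * eval (fun l => (z l : ℂ)) (pderiv j f))
      - (p.cpp * (z i + z j) ^ 2 + p.c0p * (z i + z j) + p.c00)
        * eval (fun l => (z l : ℂ)) (rename (Equiv.swap i j) f)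
      + (2 * p.cpp * (1 - p.m) * z i * z j + p.cpp * (z i ^ 2 + z j ^ 2)
        + p.c0p * (1 - p.m / 2) * (z i + z j) + p.c00) * eval (fun l => (z l : ℂ)) f := by
  have hw' : (z i : ℂ) - z j ≠ 0 := sub_ne_zero.2 fun h => hz (by exact_mod_cast h)
  have hij : i ≠ j := by
    rintro rfl
    exact hz rfl
  generalize hwz : (fun l => (z l : ℂ)) = w
  have hi : (z i : ℂ) = w i := congrFun hwz i
  have hj : (z j : ℂ) = w j := congrFun hwz j
  rw [hi, hj] at hw'
  have hw : w i ≠ w j := sub_ne_zero.1 hw'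
  simp only [twoBody, anticomm, LinearMap.add_apply, LinearMap.sub_apply, LinearMap.smul_apply,
    Module.End.mul_apply, dMinus_apply, dZero_apply, dPlus_apply, aZero_apply, aPlus_apply,
    map_add, map_sub, map_smul, smul_eval, map_mul, eval_X,
    Derivation.leibniz, pderiv_X_self, pderiv_X_of_ne hij,
    pderiv_X_of_ne hij.symm, smul_eq_mul, map_one, map_zero,
    eval_pderiv_divDiff_left _ _ hw, eval_pderiv_divDiff_right _ _ hw, eval_divDiff _ _ hw,
    rename_X, Equiv.swap_apply_left, Equiv.swap_apply_right, rename_swap_pderiv,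
    rename_swap_pderiv', polyP, Polynomial.eval_add, Polynomial.eval_mul, Polynomial.eval_C,
    Polynomial.eval_pow, Polynomial.eval_X, Polynomial.derivative_mul,
    Polynomial.derivative_C, Polynomial.derivative_X, Polynomial.derivative_X_pow,
    Polynomial.eval_zero, Polynomial.eval_one]
  push_cast
  rw [hi, hj]
  generalize eval w (pderiv i f) = fx
  generalize eval w (pderiv j f) = fy
  generalize eval w (pderiv i (rename (Equiv.swap i j) f)) = kx
  generalize eval w (pderiv j (rename (Equiv.swap i j) f)) = ky
  generalize eval w (rename (Equiv.swap i j) f) = k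
  generalize eval w f = f
  generalize w i = x at *
  generalize w j = y at *
  field_simp
  ring

/-! ### Sums over pairs -/

section Sums

variable {R : Type*} [AddCommMonoid R]

theorem sum_ne_comm (F : Fin N → Fin N → R) :
    ∑ i, ∑ j with j ≠ i, F i j = ∑ i, ∑ j with j ≠ i, F j i :=
  Finset.sum_comm' fun i j => by simp [ne_comm]

theorem sum_lt_add_sum_lt (F : Fin N → Fin N → R) (hF : ∀ i j, F i j = F j i) :
    ∑ i, ∑ j with i < j, F i j + ∑ i, ∑ j with i < j, F i j = ∑ i, ∑ j with j ≠ i, F i j := by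
  have h : ∑ i, ∑ j with i < j, F i j = ∑ i, ∑ j with j < i, F i j := by
    rw [Finset.sum_comm' (t' := Finset.univ) (s' := fun j => Finset.univ.filter (· < j))
      (by simp)]
    exact Finset.sum_congr rfl fun i _ => Finset.sum_congr rfl fun j _ => hF _ _
  conv_lhs => rw [h]
  nth_rewrite 2 [← h]
  rw [← Finset.sum_add_distrib]
  refine Finset.sum_congr rfl fun i _ => ?_
  rw [← Finset.sum_union (Finset.disjoint_left.2 fun j hj hj' => by
    simp only [Finset.mem_filter] at hj hj'
    exact lt_asymm hj.2 hj'.2)]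
  refine Finset.sum_congr (Finset.ext fun j => ?_) fun _ _ => rfl
  simp [lt_or_lt_iff_ne]

end Sums

/-! ### Real powers and logarithmic derivatives -/

theorem hasDerivAt_cpow_ofReal (a : ℂ) {x : ℝ} (hx : x ≠ 0) :
    HasDerivAt (fun y : ℝ => (y : ℂ) ^ a) (a / x * (x : ℂ) ^ a) x := by
  rcases eq_or_ne a 0 with rfl | ha
  · simpa using hasDerivAt_const x (1 : ℂ)
  · convert hasDerivAt_ofReal_cpow_const hx ha using 1
    rw [Complex.cpow_sub _ _ (by exact_mod_cast hx), Complex.cpow_one]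
    ring

/-- The principal power `y ↦ y ^ a` is smooth on both half-lines: the argument of `y` is
locally constant there. -/
theorem contDiffAt_cpow_ofReal (a : ℂ) {x : ℝ} (hx : x ≠ 0) :
    ContDiffAt ℝ ∞ (fun y : ℝ => (y : ℂ) ^ a) x := by
  have harg : ∀ᶠ y : ℝ in 𝓝 x, (y : ℂ).arg = (x : ℂ).arg := by
    rcases hx.lt_or_gt with h | h
    · filter_upwards [gt_mem_nhds h] with y hy
      rw [Complex.arg_ofReal_of_neg hy, Complex.arg_ofReal_of_neg h]
    · filter_upwards [lt_mem_nhds h] with y hy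
      rw [Complex.arg_ofReal_of_nonneg hy.le, Complex.arg_ofReal_of_nonneg h.le]
  have h : ContDiffAt ℝ ∞ (fun y : ℝ =>
      Complex.exp (((Real.log y : ℝ) + (x : ℂ).arg * Complex.I) * a)) x := by
    have h1 : ContDiffAt ℝ ∞ (fun y : ℝ => ((Real.log y : ℝ) : ℂ)) x :=
      Complex.ofRealCLM.contDiff.contDiffAt.comp x (Real.contDiffAt_log.2 hx)
    exact ((h1.add contDiffAt_const).mul contDiffAt_const).cexp
  refine h.congr_of_eventuallyEq ?_
  filter_upwards [harg, eventually_ne_nhds hx] with y hy hy0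
  rw [Complex.cpow_def_of_ne_zero (by exact_mod_cast hy0), Complex.log, hy, Complex.norm_real,
    Real.norm_eq_abs, Real.log_abs]

/-- Logarithmic derivatives of the factors of a product add up. -/
theorem hasDerivAt_prod_of_logDeriv {ι : Type*} (s : Finset ι) {f : ι → ℝ → ℂ} {c : ι → ℂ} {x : ℝ}
    (h : ∀ i ∈ s, HasDerivAt (f i) (c i * f i x) x) :
    HasDerivAt (fun t => ∏ i ∈ s, f i t) ((∑ i ∈ s, c i) * ∏ i ∈ s, f i x) x := by
  classical
  induction s using Finset.induction_on with
  | empty => simpa using hasDerivAt_const x (1 : ℂ)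
  | insert i s hi ih =>
    simp only [Finset.prod_insert hi, Finset.sum_insert hi]
    refine ((h i (by simp)).mul (ih fun j hj => h j (by simp [hj]))).congr_deriv ?_
    ring

/-! ### The differential equation of the change of variables -/

section ODE

variable {D : Set ℝ} {q : Polynomial ℝ} {y : ℝ → ℝ}

/-- Derivatives have the intermediate value property, so `y'` cannot change its sign. -/
theorem eventually_deriv_eq_sqrt (hD : IsOpen D)
    (h : ∀ t ∈ D, 0 < q.eval (y t) ∧ ∃ d, HasDerivAt y d t ∧ d ^ 2 = q.eval (y t))
    {t : ℝ} (ht : t ∈ D) :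
    ∃ ε : ℝ, ε ^ 2 = 1 ∧ ∀ᶠ r in 𝓝 t, deriv y r = ε * √(q.eval (y r)) := by
  obtain ⟨δ, hδ, hball⟩ := Metric.isOpen_iff.1 hD t ht
  have hd : ∀ r ∈ Metric.ball t δ, HasDerivAt y (deriv y r) r ∧ deriv y r ^ 2 = q.eval (y r) :=
    fun r hr => by
      obtain ⟨-, d, hd, hd2⟩ := h r (hball hr)
      rw [hd.deriv]
      exact ⟨hd, hd2⟩
  have hne : ∀ r ∈ Metric.ball t δ, deriv y r ≠ 0 := fun r hr h0 => by
    have h1 := (hd r hr).2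
    have h2 := (h r (hball hr)).1
    rw [h0] at h1
    norm_num at h1
    exact h2.ne h1
  rcases hasDerivWithinAt_forall_lt_or_forall_gt_of_forall_ne (convex_ball t δ)
    (fun r hr => (hd r hr).1.hasDerivWithinAt) hne with hs | hs
  · refine ⟨-1, by norm_num, ?_⟩
    filter_upwards [Metric.ball_mem_nhds t hδ] with r hr
    rw [← (hd r hr).2, Real.sqrt_sq_eq_abs, abs_of_neg (hs r hr)]
    ring
  · refine ⟨1, by norm_num, ?_⟩
    filter_upwards [Metric.ball_mem_nhds t hδ] with r hr
    rw [← (hd r hr).2, Real.sqrt_sq_eq_abs, abs_of_pos (hs r hr), one_mul]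

/-- Bootstrapping: `y' = ± √(q(y))` is locally as smooth as `y`. -/
theorem contDiffOn_of_deriv_sq_eq (hD : IsOpen D)
    (h : ∀ t ∈ D, 0 < q.eval (y t) ∧ ∃ d, HasDerivAt y d t ∧ d ^ 2 = q.eval (y t)) :
    ContDiffOn ℝ ∞ y D := by
  have hdiff : DifferentiableOn ℝ y D := fun t ht => by
    obtain ⟨-, d, hd, -⟩ := h t ht
    exact hd.differentiableAt.differentiableWithinAt
  refine contDiffOn_infty.2 fun n => ?_
  induction n with
  | zero => exact contDiffOn_zero.2 hdiff.continuousOn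
  | succ n ih =>
    push_cast
    refine (contDiffOn_succ_iff_deriv_of_isOpen hD).2 ⟨hdiff, fun h => by simp at h, fun t ht => ?_⟩
    obtain ⟨ε, -, hε⟩ := eventually_deriv_eq_sqrt hD h ht
    have h1 : ContDiffAt ℝ n (fun r => q.eval (y r)) t :=
      ContDiffAt.comp t (f := y) (g := fun r => q.eval r) (by
        simp only [← Polynomial.coe_aeval_eq_eval]
        exact (Polynomial.contDiff_aeval q n).contDiffAt)
        (ih.contDiffAt (hD.mem_nhds ht))
    have h2 : ContDiffAt ℝ n (fun r => ε * √(q.eval (y r))) t :=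
      contDiffAt_const.mul (h1.sqrt (h t ht).1.ne')
    exact (h2.congr_of_eventuallyEq hε).contDiffWithinAt

/-- Differentiating `y'² = q(y)` gives `y'' = q'(y) / 2`. -/
theorem hasDerivAt_deriv_of_deriv_sq_eq (hD : IsOpen D)
    (h : ∀ t ∈ D, 0 < q.eval (y t) ∧ ∃ d, HasDerivAt y d t ∧ d ^ 2 = q.eval (y t))
    {t : ℝ} (ht : t ∈ D) :
    HasDerivAt (deriv y) (q.derivative.eval (y t) / 2) t := by
  obtain ⟨ε, hε1, hε⟩ := eventually_deriv_eq_sqrt hD h ht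
  obtain ⟨hpos, d, hd, -⟩ := h t ht
  have hdt : d = ε * √(q.eval (y t)) := by rw [← hε.self_of_nhds, hd.deriv]
  have h1 : HasDerivAt (fun r => q.eval (y r)) (q.derivative.eval (y t) * d) t :=
    (q.hasDerivAt (y t)).comp t hd
  refine ((h1.sqrt hpos.ne').const_mul ε).congr_of_eventuallyEq hε |>.congr_deriv ?_
  have hs : √(q.eval (y t)) ≠ 0 := (Real.sqrt_pos.2 hpos).ne'
  rw [hdt]
  field_simp
  rw [hε1]
  ring

end ODE

/-! ### The gauge factor -/

section Gauge

variable (p : Params)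

/-- The logarithmic derivative of the gauge factor with respect to `z_i`. -/
def gaugeLogDeriv (z : Fin N → ℝ) (i : Fin N) : ℝ :=
  p.a * ∑ j with j ≠ i, 1 / (z i - z j)
    + ((polyQt N p).eval (z i) - (polyP p).derivative.eval (z i) / 2) /
      (2 * (polyP p).eval (z i))

theorem hasDerivAt_update_apply (z : Fin N → ℝ) (i k : Fin N) (t : ℝ) :
    HasDerivAt (fun t => Function.update z i t k) ((Pi.single i 1 : Fin N → ℝ) k) t :=
  hasDerivAt_pi.1 (hasDerivAt_update z i t) k

theorem sum_lt_single (z : Fin N → ℝ) (i : Fin N) :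
    ∑ k, ∑ l with k < l,
        ((Pi.single i 1 : Fin N → ℝ) k - (Pi.single i 1 : Fin N → ℝ) l) / (z k - z l) =
      ∑ j with j ≠ i, 1 / (z i - z j) := by
  have h1 := sum_lt_add_sum_lt
    (fun k l => ((Pi.single i 1 : Fin N → ℝ) k - (Pi.single i 1 : Fin N → ℝ) l : ℝ) / (z k - z l))
    fun k l => by rw [← neg_sub, ← neg_sub (z l), neg_div_neg_eq]
  have h2 : ∀ k, ∑ l with l ≠ k, (Pi.single i 1 : Fin N → ℝ) k / (z k - z l) =
      if k = i then ∑ j with j ≠ i, 1 / (z i - z j) else 0 := fun k => by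
    split_ifs with h
    · subst h
      simp
    · simp [h]
  have h3 : ∑ k, ∑ l with l ≠ k, (Pi.single i 1 : Fin N → ℝ) k / (z k - z l) =
      ∑ j with j ≠ i, 1 / (z i - z j) := by
    simp only [h2, Finset.sum_ite_eq', Finset.mem_univ, if_true]
  have h4 : ∑ k, ∑ l with l ≠ k, (Pi.single i 1 : Fin N → ℝ) l / (z k - z l) =
      -∑ j with j ≠ i, 1 / (z i - z j) := by
    rw [sum_ne_comm, ← h3, ← Finset.sum_neg_distrib]
    refine Finset.sum_congr rfl fun k _ => ?_
    rw [← Finset.sum_neg_distrib]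
    exact Finset.sum_congr rfl fun l _ => by rw [← neg_sub, div_neg]
  simp only [sub_div, Finset.sum_sub_distrib, h3, h4] at h1 ⊢
  linarith

theorem hasDerivAt_gauge {E : ℝ → ℝ} {z : Fin N → ℝ} (hz : ∀ k l, k ≠ l → z k ≠ z l) (i : Fin N)
    (hP : 0 < (polyP p).eval (z i))
    (hE : HasDerivAt E ((polyQt N p).eval (z i) / (2 * (polyP p).eval (z i))) (z i)) :
    HasDerivAt (fun t => gauge p E (Function.update z i t))
      (gaugeLogDeriv p z i * gauge p E z) (z i) := by
  have hpair : HasDerivAt (fun t => ∏ k, ∏ l with k < l,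
      ((Function.update z i t k - Function.update z i t l : ℝ) : ℂ) ^ (p.a : ℂ))
      ((∑ k, ∑ l with k < l,
        ((p.a * (((Pi.single i 1 : Fin N → ℝ) k - (Pi.single i 1 : Fin N → ℝ) l)
          / (z k - z l)) : ℝ) : ℂ))
        * ∏ k, ∏ l with k < l, ((z k - z l : ℝ) : ℂ) ^ (p.a : ℂ)) (z i) := by
    have : ∀ k l, k < l → HasDerivAt (fun t =>
        ((Function.update z i t k - Function.update z i t l : ℝ) : ℂ) ^ (p.a : ℂ))
        (((p.a * (((Pi.single i 1 : Fin N → ℝ) k - (Pi.single i 1 : Fin N → ℝ) l)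
          / (z k - z l)) : ℝ) : ℂ)
        * ((Function.update z i (z i) k - Function.update z i (z i) l : ℝ) : ℂ) ^ (p.a : ℂ))
        (z i) := fun k l hkl => by
      have hne : z k - z l ≠ 0 := sub_ne_zero.2 (hz k l hkl.ne)
      have h1 : HasDerivAt (fun t => Function.update z i t k - Function.update z i t l)
          ((Pi.single i 1 : Fin N → ℝ) k - (Pi.single i 1 : Fin N → ℝ) l) (z i) :=
        (hasDerivAt_update_apply z i k (z i)).sub (hasDerivAt_update_apply z i l (z i))
      refine (HasDerivAt.scomp (z i) (g₁ := fun y : ℝ => (y : ℂ) ^ (p.a : ℂ))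
        (by
          rw [Function.update_eq_self]
          exact hasDerivAt_cpow_ofReal (p.a : ℂ) hne) h1).congr_deriv ?_
      rw [Function.update_eq_self, Complex.real_smul]
      push_cast
      ring
    refine (hasDerivAt_prod_of_logDeriv Finset.univ fun k _ =>
      hasDerivAt_prod_of_logDeriv _ fun l hl => this k l (Finset.mem_filter.1 hl).2).congr_deriv ?_
    simp only [Function.update_eq_self]
  have hone : HasDerivAt (fun t => ∏ k, (((polyP p).eval (Function.update z i t k) ^ (-(1 / 4) : ℝ)
      * Real.exp (E (Function.update z i t k)) : ℝ) : ℂ))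
      ((∑ k, (((Pi.single i 1 : Fin N → ℝ) k * (((polyQt N p).eval (z i)
        - (polyP p).derivative.eval (z i) / 2) / (2 * (polyP p).eval (z i))) : ℝ) : ℂ))
        * ∏ k, (((polyP p).eval (z k) ^ (-(1 / 4) : ℝ) * Real.exp (E (z k)) : ℝ) : ℂ)) (z i) := by
    have : ∀ k, HasDerivAt (fun t => (((polyP p).eval (Function.update z i t k) ^ (-(1 / 4) : ℝ)
      * Real.exp (E (Function.update z i t k)) : ℝ) : ℂ))
      ((((Pi.single i 1 : Fin N → ℝ) k * (((polyQt N p).eval (z i)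
        - (polyP p).derivative.eval (z i) / 2) / (2 * (polyP p).eval (z i))) : ℝ) : ℂ)
        * (((polyP p).eval (Function.update z i (z i) k) ^ (-(1 / 4) : ℝ)
            * Real.exp (E (Function.update z i (z i) k)) : ℝ) : ℂ)) (z i) := fun k => by
      rcases eq_or_ne k i with rfl | hk
      · simp only [Function.update_self, Pi.single_eq_same, one_mul]
        have h1 := (((polyP p).hasDerivAt (z k)).rpow_const (p := -(1 / 4)) (Or.inl hP.ne')).mul
          hE.exp
        rw [← Complex.ofReal_mul]
        refine (h1.congr_deriv ?_).ofReal_comp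
        rw [Real.rpow_sub_one hP.ne']
        field_simp
        ring
      · simp only [Function.update_of_ne hk, Pi.single_eq_of_ne hk, zero_mul, Complex.ofReal_zero]
        exact hasDerivAt_const _ _
    refine (hasDerivAt_prod_of_logDeriv Finset.univ fun k _ => this k).congr_deriv ?_
    simp only [Function.update_eq_self]
  refine (hpair.mul hone).congr_deriv ?_
  have e1 : (∑ k, ∑ l with k < l,
      ((p.a * (((Pi.single i 1 : Fin N → ℝ) k - (Pi.single i 1 : Fin N → ℝ) l)
          / (z k - z l)) : ℝ) : ℂ)) =
      ((p.a * ∑ j with j ≠ i, 1 / (z i - z j) : ℝ) : ℂ) := by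
    rw [← sum_lt_single z i, Finset.mul_sum, Complex.ofReal_sum]
    refine Finset.sum_congr rfl fun k _ => ?_
    rw [Finset.mul_sum, Complex.ofReal_sum]
  have e2 : (∑ k, (((Pi.single i 1 : Fin N → ℝ) k * (((polyQt N p).eval (z i)
        - (polyP p).derivative.eval (z i) / 2) / (2 * (polyP p).eval (z i))) : ℝ) : ℂ)) =
      ((((polyQt N p).eval (z i) - (polyP p).derivative.eval (z i) / 2) /
        (2 * (polyP p).eval (z i)) : ℝ) : ℂ) := by
    rw [← Complex.ofReal_sum, ← Finset.sum_mul, Finset.sum_pi_single']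
    simp
  rw [e1, e2, gaugeLogDeriv, gauge, Complex.ofReal_add]
  simp only [Function.update_eq_self]
  ring

theorem hasDerivAt_gaugeLogDeriv {z : Fin N → ℝ} (hz : ∀ k l, k ≠ l → z k ≠ z l) (i : Fin N)
    (hP : 0 < (polyP p).eval (z i)) :
    HasDerivAt (fun t => gaugeLogDeriv p (Function.update z i t) i)
      (-(p.a * ∑ j with j ≠ i, 1 / (z i - z j) ^ 2)
        + (((polyQt N p).derivative.eval (z i) - (polyP p).derivative.derivative.eval (z i) / 2)
            * (2 * (polyP p).eval (z i))
          - ((polyQt N p).eval (z i) - (polyP p).derivative.eval (z i) / 2)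
            * (2 * (polyP p).derivative.eval (z i))) / (2 * (polyP p).eval (z i)) ^ 2) (z i) := by
  unfold gaugeLogDeriv
  simp only [Function.update_self]
  refine HasDerivAt.add ?_ (((((polyQt N p).hasDerivAt (z i)).sub
    (((polyP p).derivative.hasDerivAt (z i)).div_const 2)).div
    (((polyP p).hasDerivAt (z i)).const_mul 2) (by positivity)))
  rw [← mul_neg, ← Finset.sum_neg_distrib]
  refine HasDerivAt.const_mul _ (HasDerivAt.fun_sum fun j hj => ?_)
  have hj' := (Finset.mem_filter.1 hj).2
  simp only [Function.update_of_ne hj', one_div]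
  have h := ((hasDerivAt_id (z i)).sub_const (z j)).inv (sub_ne_zero.2 (hz i j hj'.symm))
  refine h.congr_deriv ?_
  simp [neg_div]

theorem gauge_ne_zero {E : ℝ → ℝ} {z : Fin N → ℝ} (hz : ∀ k l, k ≠ l → z k ≠ z l)
    (hP : ∀ i, 0 < (polyP p).eval (z i)) : gauge p E z ≠ 0 := by
  refine mul_ne_zero (Finset.prod_ne_zero_iff.2 fun k _ => Finset.prod_ne_zero_iff.2 fun l hl => ?_)
    (Finset.prod_ne_zero_iff.2 fun k _ => ?_)
  · have := hz k l (Finset.mem_filter.1 hl).2.ne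
    rw [Complex.cpow_def_of_ne_zero (by exact_mod_cast sub_ne_zero.2 this)]
    exact Complex.exp_ne_zero _
  · have := Real.rpow_pos_of_pos (hP k) (-(1 / 4))
    exact_mod_cast (mul_pos this (Real.exp_pos _)).ne'

theorem hasDerivAt_eval_update (f : MvPolynomial (Fin N) ℂ) (z : Fin N → ℝ) (i : Fin N) :
    HasDerivAt (fun t : ℝ => eval (fun l => (Function.update z i t l : ℂ)) f)
      (eval (fun l => (z l : ℂ)) (pderiv i f)) (z i) := by
  induction f using MvPolynomial.induction_on with
  | C c => simpa using hasDerivAt_const (z i) c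
  | add f g hf hg => simpa using hf.fun_add hg
  | mul_X f k hf =>
    have h1 := hf.mul (hasDerivAt_update_apply z i k (z i)).ofReal_comp
    simp only [map_mul, eval_X]
    refine h1.congr_deriv ?_
    rw [Function.update_eq_self, Derivation.leibniz, pderiv_X]
    rcases eq_or_ne k i with rfl | hk
    · simp
      ring
    · simp [hk]
      ring

end Gauge

/-! ### Derivatives of gauged polynomials -/

/-- The hypotheses on the change of variables: `ζ_i' ^ 2 = P(ζ_i) > 0`, the `ζ_i(x_i)` are pairwise
different, and `E' = Q̃ / (2P)` at the points `ζ_i(x_i)`, for all `x ∈ U`. -/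
structure Admissible (p : Params) (U : Set (Fin N → ℝ)) (ζ : Fin N → ℝ → ℝ) (E : ℝ → ℝ) :
    Prop where
  isOpen : IsOpen U
  pos : ∀ x ∈ U, ∀ i, 0 < (polyP p).eval (ζ i (x i))
  deriv_sq : ∀ x ∈ U, ∀ i, ∃ d : ℝ, HasDerivAt (ζ i) d (x i) ∧ d ^ 2 = (polyP p).eval (ζ i (x i))
  ne : ∀ x ∈ U, ∀ i j, i ≠ j → ζ i (x i) ≠ ζ j (x j)
  hasDerivAt_E : ∀ x ∈ U, ∀ i, HasDerivAt E
    ((polyQt N p).eval (ζ i (x i)) / (2 * (polyP p).eval (ζ i (x i)))) (ζ i (x i))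

variable {p : Params} {U : Set (Fin N → ℝ)} {ζ : Fin N → ℝ → ℝ} {E : ℝ → ℝ}

theorem changeVar_update (x : Fin N → ℝ) (i : Fin N) (t : ℝ) :
    changeVar ζ (Function.update x i t) = Function.update (changeVar ζ x) i (ζ i t) := by
  funext k
  rcases eq_or_ne k i with rfl | hk
  · simp [changeVar]
  · simp [changeVar, hk]

namespace Admissible

variable (A : Admissible p U ζ E)

include A

theorem isOpen_proj (i : Fin N) : IsOpen ((fun x : Fin N → ℝ => x i) '' U) :=
  isOpenMap_eval i U A.isOpen

theorem ode (i : Fin N) : ∀ t ∈ (fun x : Fin N → ℝ => x i) '' U, 0 < (polyP p).eval (ζ i t) ∧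
    ∃ d, HasDerivAt (ζ i) d t ∧ d ^ 2 = (polyP p).eval (ζ i t) := by
  rintro _ ⟨x, hx, rfl⟩
  exact ⟨A.pos x hx i, A.deriv_sq x hx i⟩

theorem contDiffOn_ζ (i : Fin N) : ContDiffOn ℝ ∞ (ζ i) ((fun x : Fin N → ℝ => x i) '' U) :=
  contDiffOn_of_deriv_sq_eq (A.isOpen_proj i) (A.ode i)

variable {x : Fin N → ℝ} (hx : x ∈ U)

include hx

theorem hasDerivAt_ζ (i : Fin N) : HasDerivAt (ζ i) (deriv (ζ i) (x i)) (x i) := by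
  obtain ⟨d, hd, -⟩ := A.deriv_sq x hx i
  rwa [hd.deriv]

theorem deriv_ζ_sq (i : Fin N) : deriv (ζ i) (x i) ^ 2 = (polyP p).eval (ζ i (x i)) := by
  obtain ⟨d, hd, hd2⟩ := A.deriv_sq x hx i
  rwa [hd.deriv]

theorem hasDerivAt_deriv_ζ (i : Fin N) :
    HasDerivAt (deriv (ζ i)) ((polyP p).derivative.eval (ζ i (x i)) / 2) (x i) :=
  hasDerivAt_deriv_of_deriv_sq_eq (A.isOpen_proj i) (A.ode i) ⟨x, hx, rfl⟩

theorem eventually_update_mem (i : Fin N) : ∀ᶠ t in 𝓝 (x i), Function.update x i t ∈ U := by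
  have hc : Continuous fun t : ℝ => Function.update x i t := continuous_const.update i continuous_id
  refine hc.continuousAt.eventually_mem (A.isOpen.mem_nhds ?_)
  simpa using hx

theorem gauge_changeVar_ne_zero : gauge p E (changeVar ζ x) ≠ 0 :=
  gauge_ne_zero p (A.ne x hx) (A.pos x hx)

/-- A function of `z` that is differentiable in `z_i` is differentiable in `x_i`. -/
theorem hasDerivAt_comp_changeVar {G : (Fin N → ℝ) → ℂ} {G' : ℂ} (i : Fin N)
    (hG : HasDerivAt (fun t => G (Function.update (changeVar ζ x) i t)) G' (changeVar ζ x i)) :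
    HasDerivAt (fun t => G (changeVar ζ (Function.update x i t)))
      (((deriv (ζ i) (x i) : ℝ) : ℂ) * G') (x i) := by
  simp only [changeVar_update]
  have := HasDerivAt.scomp (x i) (h := ζ i) hG (A.hasDerivAt_ζ hx i)
  rwa [Complex.real_smul] at this

theorem hasDerivAt_gauge_mul_eval (f : MvPolynomial (Fin N) ℂ) (i : Fin N) :
    HasDerivAt (fun t => gauge p E (Function.update (changeVar ζ x) i t) *
        eval (fun l => (Function.update (changeVar ζ x) i t l : ℂ)) f)
      (gauge p E (changeVar ζ x) * (gaugeLogDeriv p (changeVar ζ x) i *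
        eval (fun l => (changeVar ζ x l : ℂ)) f
          + eval (fun l => (changeVar ζ x l : ℂ)) (pderiv i f))) (changeVar ζ x i) := by
  refine ((hasDerivAt_gauge p (z := changeVar ζ x) (A.ne x hx) i (A.pos x hx i)
    (A.hasDerivAt_E x hx i)).mul
    (hasDerivAt_eval_update f (changeVar ζ x) i)).congr_deriv ?_
  simp only [Function.update_eq_self]
  ring

theorem hasDerivAt_first (f : MvPolynomial (Fin N) ℂ) (i : Fin N) :
    HasDerivAt (fun t => gauge p E (changeVar ζ (Function.update x i t)) *
        eval (fun l => (changeVar ζ (Function.update x i t) l : ℂ)) f)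
      (((deriv (ζ i) (x i) : ℝ) : ℂ) * (gauge p E (changeVar ζ x) *
        (gaugeLogDeriv p (changeVar ζ x) i * eval (fun l => (changeVar ζ x l : ℂ)) f
          + eval (fun l => (changeVar ζ x l : ℂ)) (pderiv i f)))) (x i) :=
  A.hasDerivAt_comp_changeVar hx (G := fun z => gauge p E z * eval (fun l => (z l : ℂ)) f) i
    (A.hasDerivAt_gauge_mul_eval hx f i)

/-- The derivative of the right-hand side of `hasDerivAt_first`, by `ζ_i' ^ 2 = P(ζ_i)` and
`ζ_i'' = P'(ζ_i) / 2`. -/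
theorem hasDerivAt_second (f : MvPolynomial (Fin N) ℂ) (i : Fin N) {u' : ℝ}
    (hu : HasDerivAt (fun t => gaugeLogDeriv p (Function.update (changeVar ζ x) i t) i) u'
      (changeVar ζ x i)) :
    HasDerivAt (fun t => ((deriv (ζ i) t : ℝ) : ℂ) *
      (gauge p E (changeVar ζ (Function.update x i t)) *
        (gaugeLogDeriv p (changeVar ζ (Function.update x i t)) i
          * eval (fun l => (changeVar ζ (Function.update x i t) l : ℂ)) f
          + eval (fun l => (changeVar ζ (Function.update x i t) l : ℂ)) (pderiv i f))))
      (gauge p E (changeVar ζ x) *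
        (((polyP p).eval (changeVar ζ x i) : ℝ) *
          (eval (fun l => (changeVar ζ x l : ℂ)) (pderiv i (pderiv i f))
            + 2 * gaugeLogDeriv p (changeVar ζ x) i
              * eval (fun l => (changeVar ζ x l : ℂ)) (pderiv i f)
            + ((gaugeLogDeriv p (changeVar ζ x) i : ℂ) ^ 2 + u')
              * eval (fun l => (changeVar ζ x l : ℂ)) f)
          + ((polyP p).derivative.eval (changeVar ζ x i) / 2 : ℝ) *
            (gaugeLogDeriv p (changeVar ζ x) i * eval (fun l => (changeVar ζ x l : ℂ)) f
              + eval (fun l => (changeVar ζ x l : ℂ)) (pderiv i f)))) (x i) := by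
  have h1 := A.hasDerivAt_comp_changeVar hx
    (G := fun z => gauge p E z * eval (fun l => (z l : ℂ)) f * (gaugeLogDeriv p z i : ℂ)
      + gauge p E z * eval (fun l => (z l : ℂ)) (pderiv i f)) i
    (((A.hasDerivAt_gauge_mul_eval hx f i).mul hu.ofReal_comp).add
      (A.hasDerivAt_gauge_mul_eval hx (pderiv i f) i))
  have h2 := (A.hasDerivAt_deriv_ζ hx i).ofReal_comp.mul h1
  refine (h2.congr_of_eventuallyEq (Eventually.of_forall fun t => ?_)).congr_deriv ?_
  · simp only [Pi.mul_apply]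
    ring
  · have hsq : ((deriv (ζ i) (x i) : ℝ) : ℂ) * ((deriv (ζ i) (x i) : ℝ) : ℂ) =
        (((polyP p).eval (changeVar ζ x i) : ℝ) : ℂ) := by
      rw [← Complex.ofReal_mul, ← sq, A.deriv_ζ_sq hx i]
      rfl
    simp only [Function.update_eq_self]
    rw [← hsq]
    simp only [changeVar]
    ring

omit A hx in
theorem pullback_apply_of_mem (F : SpinPoly N s) (hx : x ∈ U) (σ : Config N s) :
    pullback s p U ζ E F x σ =
      gauge p E (changeVar ζ x) * eval (fun l => (changeVar ζ x l : ℂ)) (F σ) := by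
  simp [pullback, hx]

theorem iteratedDeriv_pullback (F : SpinPoly N s) (i : Fin N) {u' : ℝ}
    (hu : HasDerivAt (fun t => gaugeLogDeriv p (Function.update (changeVar ζ x) i t) i) u'
      (changeVar ζ x i)) (σ : Config N s) :
    iteratedDeriv 2 (fun t : ℝ => pullback s p U ζ E F (Function.update x i t)) (x i) σ =
      gauge p E (changeVar ζ x) *
        (((polyP p).eval (changeVar ζ x i) : ℝ) *
          (eval (fun l => (changeVar ζ x l : ℂ)) (pderiv i (pderiv i (F σ)))
            + 2 * gaugeLogDeriv p (changeVar ζ x) i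
              * eval (fun l => (changeVar ζ x l : ℂ)) (pderiv i (F σ))
            + ((gaugeLogDeriv p (changeVar ζ x) i : ℂ) ^ 2 + u')
              * eval (fun l => (changeVar ζ x l : ℂ)) (F σ))
          + ((polyP p).derivative.eval (changeVar ζ x i) / 2 : ℝ) *
            (gaugeLogDeriv p (changeVar ζ x) i * eval (fun l => (changeVar ζ x l : ℂ)) (F σ)
              + eval (fun l => (changeVar ζ x l : ℂ)) (pderiv i (F σ)))) := by
  have hderiv : ∀ y ∈ U, HasDerivAt
      (fun t : ℝ => pullback s p U ζ E F (Function.update y i t))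
      (fun τ => ((deriv (ζ i) (y i) : ℝ) : ℂ) * (gauge p E (changeVar ζ y) *
        (gaugeLogDeriv p (changeVar ζ y) i * eval (fun l => (changeVar ζ y l : ℂ)) (F τ)
          + eval (fun l => (changeVar ζ y l : ℂ)) (pderiv i (F τ))))) (y i) := fun y hy => by
    refine hasDerivAt_pi.2 fun τ => (A.hasDerivAt_first hy (F τ) i).congr_of_eventuallyEq ?_
    filter_upwards [A.eventually_update_mem hy i] with t ht
    exact pullback_apply_of_mem F ht τ
  have hd : deriv (fun t : ℝ => pullback s p U ζ E F (Function.update x i t)) =ᶠ[𝓝 (x i)]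
      fun t τ => ((deriv (ζ i) t : ℝ) : ℂ) * (gauge p E (changeVar ζ (Function.update x i t)) *
        (gaugeLogDeriv p (changeVar ζ (Function.update x i t)) i
          * eval (fun l => (changeVar ζ (Function.update x i t) l : ℂ)) (F τ)
          + eval (fun l => (changeVar ζ (Function.update x i t) l : ℂ)) (pderiv i (F τ)))) := by
    filter_upwards [A.eventually_update_mem hx i] with t ht
    have := (hderiv _ ht).deriv
    simpa only [Function.update_idem, Function.update_self] using this
  rw [iteratedDeriv_succ, iteratedDeriv_one]
  have h2 := (hasDerivAt_pi.2 fun τ => A.hasDerivAt_second hx (F τ) i hu).congr_of_eventuallyEq hd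
  exact congrFun h2.deriv σ

end Admissible

/-! ### Smoothness -/

theorem contDiff_eval (f : MvPolynomial (Fin N) ℂ) :
    ContDiff ℝ ∞ fun z : Fin N → ℝ => eval (fun l => (z l : ℂ)) f := by
  induction f using MvPolynomial.induction_on with
  | C c => simpa using contDiff_const
  | add f g hf hg => simpa using hf.add hg
  | mul_X f k hf =>
    simp only [map_mul, eval_X]
    exact hf.mul (Complex.ofRealCLM.contDiff.comp (contDiff_apply ℝ ℝ k))

namespace Admissible

variable (A : Admissible p U ζ E)

include A

theorem contDiffAt_coord {x : Fin N → ℝ} (hx : x ∈ U) (i : Fin N) :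
    ContDiffAt ℝ ∞ (fun y : Fin N → ℝ => ζ i (y i)) x :=
  ((A.contDiffOn_ζ i).contDiffAt ((A.isOpen_proj i).mem_nhds ⟨x, hx, rfl⟩)).comp x
    (contDiff_apply ℝ ℝ i).contDiffAt

/-- `E ∘ ζ_i` is smooth because its derivative is an explicit smooth function. -/
theorem contDiffOn_E (i : Fin N) :
    ContDiffOn ℝ ∞ (fun t => E (ζ i t)) ((fun x : Fin N → ℝ => x i) '' U) := by
  have hO := A.isOpen_proj i
  have hd : ∀ t ∈ (fun x : Fin N → ℝ => x i) '' U, HasDerivAt (fun t => E (ζ i t))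
      ((polyQt N p).eval (ζ i t) / (2 * (polyP p).eval (ζ i t)) * deriv (ζ i) t) t := by
    rintro _ ⟨x, hx, rfl⟩
    exact (A.hasDerivAt_E x hx i).comp (x i) (A.hasDerivAt_ζ hx i)
  refine (contDiffOn_infty_iff_deriv_of_isOpen hO).2
    ⟨fun t ht => (hd t ht).differentiableAt.differentiableWithinAt, ?_⟩
  have hpoly : ∀ q : Polynomial ℝ, ContDiffOn ℝ ∞ (fun t => q.eval (ζ i t))
      ((fun x : Fin N → ℝ => x i) '' U) := fun q => by
    have hq : ContDiff ℝ ∞ fun r : ℝ => q.eval r := by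
      simp only [← Polynomial.coe_aeval_eq_eval]
      exact Polynomial.contDiff_aeval q ∞
    exact hq.comp_contDiffOn (A.contDiffOn_ζ i)
  refine ContDiffOn.congr (((hpoly _).div (contDiffOn_const.mul (hpoly _)) fun t ht => ?_).mul
    ((contDiffOn_infty_iff_deriv_of_isOpen hO).1 (A.contDiffOn_ζ i)).2)
    fun t ht => (hd t ht).deriv
  have := (A.ode i t ht).1
  positivity

theorem contDiffAt_gauge {x : Fin N → ℝ} (hx : x ∈ U) :
    ContDiffAt ℝ ∞ (fun y => gauge p E (changeVar ζ y)) x := by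
  refine ContDiffAt.mul (contDiffAt_prod fun k _ => contDiffAt_prod fun l hl => ?_)
    (contDiffAt_prod fun k _ => ?_)
  · have hne : ζ k (x k) - ζ l (x l) ≠ 0 :=
      sub_ne_zero.2 (A.ne x hx k l (Finset.mem_filter.1 hl).2.ne)
    exact (contDiffAt_cpow_ofReal (p.a : ℂ) hne).comp x
      ((A.contDiffAt_coord hx k).sub (A.contDiffAt_coord hx l))
  · refine Complex.ofRealCLM.contDiff.contDiffAt.comp x (ContDiffAt.mul ?_ ?_)
    · have hq : ContDiff ℝ ∞ fun r : ℝ => (polyP p).eval r := by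
        simp only [← Polynomial.coe_aeval_eq_eval]
        exact Polynomial.contDiff_aeval _ ∞
      exact (hq.contDiffAt.comp x (A.contDiffAt_coord hx k)).rpow_const_of_ne (A.pos x hx k).ne'
    · exact (((A.contDiffOn_E k).contDiffAt ((A.isOpen_proj k).mem_nhds ⟨x, hx, rfl⟩)).comp x
        (contDiff_apply ℝ ℝ k).contDiffAt).exp

theorem pullback_mem_smoothFun (F : SpinPoly N s) : pullback s p U ζ E F ∈ smoothFun s U := by
  refine ⟨fun x hx => ?_, fun x hx => by simp [pullback, hx]⟩
  refine ContDiffAt.contDiffWithinAt (contDiffAt_pi.2 fun σ => ?_)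
  have h : ContDiffAt ℝ ∞ (fun y => gauge p E (changeVar ζ y) *
      eval (fun l => (changeVar ζ y l : ℂ)) (F σ)) x :=
    (A.contDiffAt_gauge hx).mul ((contDiff_eval (F σ)).contDiffAt.comp x
      (contDiffAt_pi.2 fun i => A.contDiffAt_coord hx i))
  refine h.congr_of_eventuallyEq ?_
  filter_upwards [A.isOpen.mem_nhds hx] with y hy
  exact pullback_apply_of_mem F hy σ

/-! ### Injectivity of the pullback -/

/-- The points `ζ(x)`, `x ∈ U`, contain a product of infinite sets. -/
theorem pullback_injective (hne : U.Nonempty) :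
    Function.Injective (pullback s p U ζ E) := by
  rw [← LinearMap.ker_eq_bot, LinearMap.ker_eq_bot']
  intro F hF
  obtain ⟨x, hx⟩ := hne
  obtain ⟨δ, hδ, hball⟩ := Metric.isOpen_iff.1 A.isOpen x hx
  have hmem : ∀ y : Fin N → ℝ, (∀ i, y i ∈ Metric.ball (x i) δ) → y ∈ U := fun y hy =>
    hball ((mem_ball_iff_norm.2 ((pi_norm_lt_iff hδ).2 fun i => by
      simpa [← dist_eq_norm] using hy i)))
  have hinf : ∀ i, ((fun t : ℝ => (ζ i t : ℂ)) '' Metric.ball (x i) δ).Infinite := fun i => by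
    have hd : ∀ t ∈ Metric.ball (x i) δ, HasDerivAt (ζ i) (deriv (ζ i) t) t ∧
        deriv (ζ i) t ≠ 0 := fun t ht => by
      have hU : Function.update x i t ∈ U := hmem _ fun k => by
        rcases eq_or_ne k i with rfl | hk
        · simpa using ht
        · simpa [hk] using hδ
      have h1 := A.hasDerivAt_ζ hU i
      have h2 := A.deriv_ζ_sq hU i
      have h3 := A.pos _ hU i
      rw [Function.update_self] at h1 h2 h3
      refine ⟨h1, fun h0 => ?_⟩
      rw [h0] at h2
      norm_num at h2
      exact h3.ne h2
    have hinj : Set.InjOn (ζ i) (Metric.ball (x i) δ) := by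
      rw [Real.ball_eq_Ioo] at hd ⊢
      have hc : ContinuousOn (ζ i) (Set.Ioo (x i - δ) (x i + δ)) := fun t ht =>
        (hd t ht).1.continuousAt.continuousWithinAt
      rcases hasDerivWithinAt_forall_lt_or_forall_gt_of_forall_ne (convex_Ioo _ _)
        (fun t ht => (hd t ht).1.hasDerivWithinAt) (fun t ht => (hd t ht).2) with h | h
      · exact (strictAntiOn_of_deriv_neg (convex_Ioo _ _) hc (by simpa using h)).injOn
      · exact (strictMonoOn_of_deriv_pos (convex_Ioo _ _) hc (by simpa using h)).injOn
    refine Set.Infinite.image (Complex.ofReal_injective.comp_injOn hinj) ?_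
    rw [Real.ball_eq_Ioo]
    exact Set.Ioo_infinite (by linarith)
  funext σ
  refine funext_set _ hinf fun w hw => ?_
  choose y hy hyw using fun i => hw i trivial
  have hyU := hmem y hy
  have h0 := congrFun (congrFun hF y) σ
  rw [pullback_apply_of_mem F hyU] at h0
  have hw' : (fun l => (changeVar ζ y l : ℂ)) = w := funext hyw
  rw [hw'] at h0
  simpa using (mul_eq_zero.1 h0).resolve_left (A.gauge_changeVar_ne_zero hyU)

end Admissible

/-! ### The gauged Hamiltonian -/

theorem potential_apply (p : Params) (z : Fin N → ℝ) (ψ : Spin N s) (σ : Config N s) :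
    potential s p z ψ σ =
      ((p.a ^ 2 * (∑ i, ∑ j with j ≠ i, ∑ k with k ≠ i ∧ k ≠ j,
          (polyP p).eval (z i) / ((z i - z j) * (z i - z k)))
        + p.a * (∑ i, ∑ j with j ≠ i, (polyQt N p).eval (z i) / (z i - z j))
        - 2 * p.a * p.cpp * (1 - (p.m : ℝ)) * (∑ i, ∑ j with i < j, z i * z j)
        + 1 / 4 * (∑ i, (1 / (polyP p).eval (z i) *
              (3 / 4 * (polyP p).derivative.eval (z i) ^ 2 + (polyQt N p).eval (z i) ^ 2
                - 2 * (polyQt N p).eval (z i) * (polyP p).derivative.eval (z i))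
            - (polyP p).derivative.derivative.eval (z i)
            + 2 * (polyQt N p).derivative.eval (z i)
            - 4 * (polyR N p).eval (z i))) : ℝ) : ℂ) * ψ σ
      + (p.a : ℂ) * (∑ i, ∑ j with i < j,
          ((((polyP p).eval (z i) + (polyP p).eval (z j)) / (z i - z j) ^ 2 : ℝ) : ℂ)
            * (p.a * ψ σ + ψ (σ ∘ Equiv.swap i j)))
      - (p.a : ℂ) * (∑ i, ∑ j with i < j,
          ((p.cpp * (z i + z j) ^ 2 + p.c0p * (z i + z j) + p.c00 : ℝ) : ℂ)
            * ψ (σ ∘ Equiv.swap i j))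
      - ((p.a ^ 2 / 12 * p.c00 : ℝ) : ℂ) * (∑ i, ∑ j with j ≠ i, ∑ k with k ≠ i ∧ k ≠ j,
          (ψ σ - ψ (σ ∘ Equiv.swap i j ∘ Equiv.swap i k))) := by
  simp only [potential, LinearMap.add_apply, LinearMap.sub_apply, LinearMap.smul_apply,
    LinearMap.sum_apply, Module.End.one_apply, Module.End.mul_apply, Pi.add_apply, Pi.sub_apply,
    Pi.smul_apply, Finset.sum_apply, smul_eq_mul, spinSwap, spinPerm, LinearMap.funLeft_apply,
    Function.comp_assoc]

/-- The square of a sum over the other particles, split into off-diagonal and diagonal terms. -/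
theorem sq_sum_ne (i : Fin N) (g : Fin N → ℝ) :
    (∑ j with j ≠ i, g j) ^ 2 =
      ∑ j with j ≠ i, ∑ k with k ≠ i ∧ k ≠ j, g j * g k + ∑ j with j ≠ i, g j ^ 2 := by
  rw [sq, Finset.sum_mul_sum, ← Finset.sum_add_distrib]
  refine Finset.sum_congr rfl fun j hj => ?_
  rw [← Finset.sum_filter_add_sum_filter_not _ (fun k => k ≠ j), Finset.filter_filter]
  congr 1
  rw [Finset.filter_filter]
  have : Finset.univ.filter (fun k => k ≠ i ∧ ¬k ≠ j) = {j} := by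
    ext k
    have := (Finset.mem_filter.1 hj).2
    simp only [Finset.mem_filter, Finset.mem_univ, true_and, Finset.mem_singleton, not_not]
    exact ⟨fun h => h.2, fun h => ⟨h ▸ this, h⟩⟩
  rw [this, Finset.sum_singleton, sq]

theorem sum_ne_const (i : Fin N) (c : ℂ) : ∑ j with j ≠ i, c = ((N : ℂ) - 1) * c := by
  rw [Finset.sum_const, Finset.filter_ne', Finset.card_erase_of_mem (Finset.mem_univ i),
    Finset.card_univ, Fintype.card_fin, nsmul_eq_mul, Nat.cast_sub (Fin.pos i), Nat.cast_one]

/-- What the particle `j` contributes to the conjugated kinetic term of the particle `i` on `f`,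
beyond `oneBody` and the scalar potential, see `kinetic_eq`. The summand `a (N - 1)` of `b` in `Q̃`
and `R` is distributed over the `N - 1` particles `j ≠ i`. -/
def pairTerm (p : Params) (z : Fin N → ℝ) (f : MvPolynomial (Fin N) ℂ) (i j : Fin N) : ℂ :=
  (2 * p.a * (polyP p).eval (z i) / (z i - z j) - p.a / 2 * (polyP p).derivative.eval (z i) : ℝ)
      * eval (fun l => (z l : ℂ)) (pderiv i f)
    + ((p.a ^ 2 - p.a) * (polyP p).eval (z i) / (z i - z j) ^ 2
        + p.a * (p.cpp * z i ^ 2 + p.c0p * (1 - p.m / 2) * z i + p.c00 / 2) : ℝ)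
      * eval (fun l => (z l : ℂ)) f

/-- After symmetrization the pair terms are matched by the pair potential, with `S_{ij} = -K_{ij}`,
and the interaction `twoBody`. -/
theorem pairTerm_add_pairTerm (p : Params) (z : Fin N → ℝ) (f : MvPolynomial (Fin N) ℂ)
    {i j : Fin N} (hz : z i ≠ z j) :
    pairTerm p z f i j + pairTerm p z f j i =
      - 2 * p.a * p.cpp * (1 - p.m) * ((z i * z j : ℝ) : ℂ) * eval (fun l => (z l : ℂ)) f
      + (p.a : ℂ) * (((((polyP p).eval (z i) + (polyP p).eval (z j)) / (z i - z j) ^ 2 : ℝ) : ℂ)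
            * (p.a * eval (fun l => (z l : ℂ)) f
              - eval (fun l => (z l : ℂ)) (rename (Equiv.swap i j) f)))
      + (p.a : ℂ) * (((p.cpp * (z i + z j) ^ 2 + p.c0p * (z i + z j) + p.c00 : ℝ) : ℂ)
            * eval (fun l => (z l : ℂ)) (rename (Equiv.swap i j) f))
      + (p.a : ℂ) * eval (fun l => (z l : ℂ)) (twoBody p i j f) := by
  rw [twoBody_eval p z hz f, pairTerm, pairTerm]
  push_cast
  have h1 : (z i : ℂ) - z j ≠ 0 := sub_ne_zero.2 fun h => hz (by exact_mod_cast h)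
  have h2 : (z j : ℂ) - z i = -(z i - z j) := by ring
  rw [h2]
  generalize eval (fun l => (z l : ℂ)) (pderiv i f) = fx
  generalize eval (fun l => (z l : ℂ)) (pderiv j f) = fy
  generalize eval (fun l => (z l : ℂ)) (rename (Equiv.swap i j) f) = k
  generalize eval (fun l => (z l : ℂ)) f = f
  field_simp
  ring

/-- The kinetic term of one particle, after conjugation with the gauge factor. -/
theorem kinetic_eq (p : Params) {z : Fin N → ℝ} (i : Fin N) (hP : 0 < (polyP p).eval (z i))
    (f : MvPolynomial (Fin N) ℂ) {u' : ℝ}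
    (hu' : u' = -(p.a * ∑ j with j ≠ i, 1 / (z i - z j) ^ 2)
        + (((polyQt N p).derivative.eval (z i) - (polyP p).derivative.derivative.eval (z i) / 2)
            * (2 * (polyP p).eval (z i))
          - ((polyQt N p).eval (z i) - (polyP p).derivative.eval (z i) / 2)
            * (2 * (polyP p).derivative.eval (z i))) / (2 * (polyP p).eval (z i)) ^ 2) :
    ((polyP p).eval (z i) : ℝ) *
        (eval (fun l => (z l : ℂ)) (pderiv i (pderiv i f))
          + 2 * gaugeLogDeriv p z i * eval (fun l => (z l : ℂ)) (pderiv i f)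
          + ((gaugeLogDeriv p z i : ℂ) ^ 2 + u') * eval (fun l => (z l : ℂ)) f)
      + ((polyP p).derivative.eval (z i) / 2 : ℝ) *
          (gaugeLogDeriv p z i * eval (fun l => (z l : ℂ)) f
            + eval (fun l => (z l : ℂ)) (pderiv i f)) =
    ((p.a ^ 2 * (∑ j with j ≠ i, ∑ k with k ≠ i ∧ k ≠ j,
          (polyP p).eval (z i) / ((z i - z j) * (z i - z k)))
        + p.a * (∑ j with j ≠ i, (polyQt N p).eval (z i) / (z i - z j))
        + 1 / 4 * (1 / (polyP p).eval (z i) *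
              (3 / 4 * (polyP p).derivative.eval (z i) ^ 2 + (polyQt N p).eval (z i) ^ 2
                - 2 * (polyQt N p).eval (z i) * (polyP p).derivative.eval (z i))
            - (polyP p).derivative.derivative.eval (z i)
            + 2 * (polyQt N p).derivative.eval (z i)
            - 4 * (polyR N p).eval (z i)) : ℝ) : ℂ) * eval (fun l => (z l : ℂ)) f
      + eval (fun l => (z l : ℂ)) (oneBody p i f)
      + ∑ j with j ≠ i, pairTerm p z f i j := by
  have hsq := sq_sum_ne i fun j => 1 / (z i - z j)
  set S := ∑ j with j ≠ i, 1 / (z i - z j) with hS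
  set T := ∑ j with j ≠ i, ∑ k with k ≠ i ∧ k ≠ j, 1 / (z i - z j) * (1 / (z i - z k)) with hT
  set q := ∑ j with j ≠ i, (1 / (z i - z j)) ^ 2 with hq
  have e1 : ∑ j with j ≠ i, ∑ k with k ≠ i ∧ k ≠ j,
      (polyP p).eval (z i) / ((z i - z j) * (z i - z k)) = (polyP p).eval (z i) * T := by
    rw [hT, Finset.mul_sum]
    refine Finset.sum_congr rfl fun j _ => ?_
    rw [Finset.mul_sum]
    exact Finset.sum_congr rfl fun k _ => by rw [div_mul_div_comm, one_mul, mul_one_div]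
  have e2 : ∑ j with j ≠ i, (polyQt N p).eval (z i) / (z i - z j) =
      (polyQt N p).eval (z i) * S := by
    rw [hS, Finset.mul_sum]
    exact Finset.sum_congr rfl fun j _ => by rw [mul_one_div]
  have e3 : ∑ j with j ≠ i, 1 / (z i - z j) ^ 2 = q :=
    Finset.sum_congr rfl fun j _ => by rw [one_div_pow]
  have e4 : ∑ j with j ≠ i, pairTerm p z f i j =
      (2 * p.a * (polyP p).eval (z i) * S
          - p.a / 2 * ((N : ℝ) - 1) * (polyP p).derivative.eval (z i) : ℝ)
        * eval (fun l => (z l : ℂ)) (pderiv i f)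
      + ((p.a ^ 2 - p.a) * (polyP p).eval (z i) * q
          + p.a * ((N : ℝ) - 1) * (p.cpp * z i ^ 2 + p.c0p * (1 - p.m / 2) * z i + p.c00 / 2) : ℝ)
        * eval (fun l => (z l : ℂ)) f := by
    have hc := sum_ne_const i
    simp only [pairTerm, Finset.sum_add_distrib, ← Finset.sum_mul, ← Complex.ofReal_sum,
      Finset.sum_sub_distrib]
    have hr : ∀ c : ℝ, ∑ j with j ≠ i, c = ((N : ℝ) - 1) * c := fun c => by
      have := hc c
      rw [← Complex.ofReal_sum] at this
      exact_mod_cast this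
    rw [hr, hr, hS, hq, Finset.mul_sum, Finset.mul_sum]
    simp only [mul_one_div, one_div_pow]
    congr 3 <;> ring
  have hQt : (polyQt N p).eval (z i) = (polyQ p).eval (z i)
      + (1 - bConst N p / 2) * (polyP p).derivative.eval (z i) := by
    simp [polyQt]
  have h1 : 2 * (polyP p).eval (z i) * gaugeLogDeriv p z i + (polyP p).derivative.eval (z i) / 2 =
      2 * p.a * (polyP p).eval (z i) * S + (polyQt N p).eval (z i) := by
    rw [gaugeLogDeriv]
    field_simp
    ring
  have h2 : (polyP p).eval (z i) * (gaugeLogDeriv p z i ^ 2 + u')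
      + (polyP p).derivative.eval (z i) / 2 * gaugeLogDeriv p z i =
      p.a ^ 2 * ((polyP p).eval (z i) * T) + (p.a ^ 2 - p.a) * (polyP p).eval (z i) * q
        + p.a * ((polyQt N p).eval (z i) * S)
        + 1 / 4 * (1 / (polyP p).eval (z i) *
              (3 / 4 * (polyP p).derivative.eval (z i) ^ 2 + (polyQt N p).eval (z i) ^ 2
                - 2 * (polyQt N p).eval (z i) * (polyP p).derivative.eval (z i))
            - (polyP p).derivative.derivative.eval (z i)
            + 2 * (polyQt N p).derivative.eval (z i)) := by
    have hT' : T = S ^ 2 - q := by rw [hsq]; ring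
    rw [gaugeLogDeriv, hu', e3, ← hS, hT']
    field_simp
    ring
  have h3 : (polyR N p).eval (z i) =
      (p.cpp * (p.m * (p.m - 1)) * z i ^ 2
          + (p.c0p * (p.m * (p.m - 1) / 2) - p.m * p.cp) * z i
          + (p.c00 * p.m ^ 2 / 4 - p.m / 2 * p.c0))
        + p.a * ((N : ℝ) - 1) * (p.cpp * z i ^ 2 + p.c0p * (1 - p.m / 2) * z i + p.c00 / 2) := by
    simp [polyR, bConst]
    ring
  have h1' := congrArg (fun r : ℝ => (r : ℂ)) h1
  have h2' := congrArg (fun r : ℝ => (r : ℂ)) h2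
  have h3' := congrArg (fun r : ℝ => (r : ℂ)) h3
  have hQt' := congrArg (fun r : ℝ => (r : ℂ)) hQt
  simp only [bConst] at hQt'
  rw [e1, e2, e4, oneBody_eval]
  push_cast at h1' h2' h3' hQt' ⊢
  linear_combination eval (fun l => (z l : ℂ)) (pderiv i f) * h1'
    + eval (fun l => (z l : ℂ)) f * h2' + eval (fun l => (z l : ℂ)) f * h3'
    + eval (fun l => (z l : ℂ)) (pderiv i f) * hQt'

/-- On antisymmetric spin polynomials the gauge factor conjugates the Hamiltonian to minus the
polynomial operator `gaugedHam`. -/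
theorem Admissible.hamiltonian_pullback (A : Admissible p U ζ E) {Φ : SpinPoly N s}
    (hΦ : IsAntisymm Φ) :
    hamiltonian p U ζ (pullback s p U ζ E Φ) =
      pullback s p U ζ E (-fun σ => gaugedHam N p (Φ σ)) := by
  funext x σ
  by_cases hx : x ∈ U
  swap
  · simp [hamiltonian, pullback, hx]
  rw [hamiltonian, Set.indicator_of_mem hx, Pi.add_apply, Pi.neg_apply, Finset.sum_apply,
    pullback_apply_of_mem _ hx, potential_apply]
  have hz : ∀ k l, k ≠ l → changeVar ζ x k ≠ changeVar ζ x l := A.ne x hx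
  have hP : ∀ i, 0 < (polyP p).eval (changeVar ζ x i) := A.pos x hx
  simp only [A.iteratedDeriv_pullback hx Φ _ (hasDerivAt_gaugeLogDeriv p hz _ (hP _)) σ,
    pullback_apply_of_mem _ hx]
  generalize changeVar ζ x = z at hz hP ⊢
  generalize hZ : ∑ i, ∑ j with i < j, z i * z j = Z
  simp only [kinetic_eq p _ (hP _) (Φ σ) rfl]
  rw [← Finset.mul_sum]
  simp only [Finset.sum_add_distrib, ← Finset.sum_mul, ← Complex.ofReal_sum, ← Finset.mul_sum]
  set f := Φ σ with hf
  set g := gauge p E z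
  have hswap : ∀ i j : Fin N, i ≠ j →
      eval (fun l => (z l : ℂ)) (Φ (σ ∘ Equiv.swap i j)) =
        -eval (fun l => (z l : ℂ)) (rename (Equiv.swap i j) f) := fun i j hij => by
    rw [hΦ.comp_swap hij, map_neg]
  have hswap2 : ∀ i j k : Fin N, j ≠ i → k ≠ i →
      eval (fun l => (z l : ℂ)) (Φ (σ ∘ Equiv.swap i j ∘ Equiv.swap i k)) =
        eval (fun l => (z l : ℂ)) (rename (Equiv.swap i k) (rename (Equiv.swap i j) f)) :=
    fun i j k hj hk => by
      rw [← Function.comp_assoc, hΦ.comp_swap hk.symm, hΦ.comp_swap hj.symm, map_neg, map_neg,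
        map_neg, neg_neg]
  -- Symmetrizing in `i` and `j` turns sums over `i ≠ j` into sums over `i < j`, and only after
  -- this do the two sides agree term by term.
  have hpair : ∑ i, ∑ j with j ≠ i, pairTerm p z f i j =
      - 2 * p.a * p.cpp * (1 - p.m) * (Z : ℂ) * eval (fun l => (z l : ℂ)) f
      + (p.a : ℂ) * (∑ i, ∑ j with i < j,
          ((((polyP p).eval (z i) + (polyP p).eval (z j)) / (z i - z j) ^ 2 : ℝ) : ℂ)
            * (p.a * eval (fun l => (z l : ℂ)) f
              - eval (fun l => (z l : ℂ)) (rename (Equiv.swap i j) f)))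
      + (p.a : ℂ) * (∑ i, ∑ j with i < j,
          ((p.cpp * (z i + z j) ^ 2 + p.c0p * (z i + z j) + p.c00 : ℝ) : ℂ)
            * eval (fun l => (z l : ℂ)) (rename (Equiv.swap i j) f))
      + (p.a : ℂ) / 2 * ∑ i, ∑ j with j ≠ i, eval (fun l => (z l : ℂ)) (twoBody p i j f) := by
    have s1 := sum_lt_add_sum_lt (fun i j => ((z i * z j : ℝ) : ℂ)) fun i j => by rw [mul_comm]
    have s2 := sum_lt_add_sum_lt (fun i j =>
      ((((polyP p).eval (z i) + (polyP p).eval (z j)) / (z i - z j) ^ 2 : ℝ) : ℂ)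
            * (p.a * eval (fun l => (z l : ℂ)) f
              - eval (fun l => (z l : ℂ)) (rename (Equiv.swap i j) f))) fun i j => by
        rw [add_comm, Equiv.swap_comm, ← neg_sub (z i), neg_sq]
    have s3 := sum_lt_add_sum_lt (fun i j =>
      ((p.cpp * (z i + z j) ^ 2 + p.c0p * (z i + z j) + p.c00 : ℝ) : ℂ)
            * eval (fun l => (z l : ℂ)) (rename (Equiv.swap i j) f)) fun i j => by
        rw [add_comm (z i), Equiv.swap_comm]
    have s4 : ∑ i, ∑ j with j ≠ i, pairTerm p z f i j + ∑ i, ∑ j with j ≠ i, pairTerm p z f i j =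
        ∑ i, ∑ j with j ≠ i, (pairTerm p z f i j + pairTerm p z f j i) := by
      simp only [Finset.sum_add_distrib]
      exact congrArg _ (sum_ne_comm (pairTerm p z f))
    have s5 : ∑ i, ∑ j with j ≠ i, (pairTerm p z f i j + pairTerm p z f j i) = _ :=
      Finset.sum_congr rfl fun i _ => Finset.sum_congr rfl fun j hj =>
        pairTerm_add_pairTerm p z f (hz i j (Finset.mem_filter.1 hj).2.symm)
    rw [s5] at s4
    simp only [Finset.sum_add_distrib, ← Finset.mul_sum, ← Finset.sum_mul] at s4
    rw [← s1, ← s2, ← s3] at s4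
    rw [← hZ]
    push_cast at s4 ⊢
    linear_combination s4 / 2
  have hT : eval (fun l => (z l : ℂ)) (gaugedHam N p f) =
      ∑ i, eval (fun l => (z l : ℂ)) (oneBody p i f)
      + (p.a : ℂ) / 2 * ∑ i, ∑ j with j ≠ i, eval (fun l => (z l : ℂ)) (twoBody p i j f)
      + (p.a : ℂ) ^ 2 / 12 * p.c00 * ∑ i, ∑ j with j ≠ i, ∑ k with k ≠ i ∧ k ≠ j,
        (eval (fun l => (z l : ℂ)) f - eval (fun l => (z l : ℂ))
          (rename (Equiv.swap i k) (rename (Equiv.swap i j) f))) := by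
    simp only [gaugedHam, LinearMap.add_apply, LinearMap.smul_apply, LinearMap.sum_apply,
      LinearMap.sub_apply, Module.End.one_apply, Module.End.mul_apply, renameEnd_apply, map_add,
      map_sum, map_sub, smul_eval]
  have hsum1 : ∀ c : Fin N → Fin N → ℂ, ∑ i, ∑ j with i < j,
      c i j * (p.a * (g * eval (fun l => (z l : ℂ)) f)
        + g * eval (fun l => (z l : ℂ)) (Φ (σ ∘ Equiv.swap i j))) =
      g * ∑ i, ∑ j with i < j, c i j * (p.a * eval (fun l => (z l : ℂ)) f
        - eval (fun l => (z l : ℂ)) (rename (Equiv.swap i j) f)) := fun c => by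
    simp only [Finset.mul_sum]
    refine Finset.sum_congr rfl fun i _ => Finset.sum_congr rfl fun j hj => ?_
    rw [hswap i j (Finset.mem_filter.1 hj).2.ne]
    ring
  have hsum2 : ∀ c : Fin N → Fin N → ℂ, ∑ i, ∑ j with i < j,
      c i j * (g * eval (fun l => (z l : ℂ)) (Φ (σ ∘ Equiv.swap i j))) =
      -(g * ∑ i, ∑ j with i < j, c i j *
        eval (fun l => (z l : ℂ)) (rename (Equiv.swap i j) f)) := fun c => by
    simp only [Finset.mul_sum, ← Finset.sum_neg_distrib]
    refine Finset.sum_congr rfl fun i _ => Finset.sum_congr rfl fun j hj => ?_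
    rw [hswap i j (Finset.mem_filter.1 hj).2.ne]
    ring
  have hsum3 : ∑ i, ∑ j with j ≠ i, ∑ k with k ≠ i ∧ k ≠ j,
      (g * eval (fun l => (z l : ℂ)) f
        - g * eval (fun l => (z l : ℂ)) (Φ (σ ∘ Equiv.swap i j ∘ Equiv.swap i k))) =
      g * ∑ i, ∑ j with j ≠ i, ∑ k with k ≠ i ∧ k ≠ j,
        (eval (fun l => (z l : ℂ)) f - eval (fun l => (z l : ℂ))
          (rename (Equiv.swap i k) (rename (Equiv.swap i j) f))) := by
    simp only [Finset.mul_sum]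
    refine Finset.sum_congr rfl fun i _ => Finset.sum_congr rfl fun j hj =>
      Finset.sum_congr rfl fun k hk => ?_
    rw [hswap2 i j k (Finset.mem_filter.1 hj).2 (Finset.mem_filter.1 hk).2.1]
    ring
  rw [hsum1, hsum2, hsum3, hpair, Pi.neg_apply, map_neg, hT]
  generalize ∑ i, ∑ j with i < j,
          ((p.cpp * (z i + z j) ^ 2 + p.c0p * (z i + z j) + p.c00 : ℝ) : ℂ)
            * eval (fun l => (z l : ℂ)) (rename (Equiv.swap i j) f) = Y
  push_cast
  ring

/-! ### Nonzero antisymmetric spin polynomials -/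

/-- The spin polynomial `z^d |σ⟩`. -/
def spinMonomial (d : Fin N → ℕ) (σ : Config N s) : SpinPoly N s :=
  Pi.single σ (monomial (Finsupp.equivFunOnFinite.symm d) 1)

/-- If the one-particle states `(d_i, σ_i)` are pairwise different, no nontrivial permutation fixes
`z^d |σ⟩`, so that its coefficient in `Λ (z^d |σ⟩)` is `1`. -/
theorem coeff_antisymmetrizer_spinMonomial {d : Fin N → ℕ} {σ : Config N s}
    (h : Function.Injective fun i => (d i, σ i)) :
    coeff (Finsupp.equivFunOnFinite.symm d) (antisymmetrizer N s (spinMonomial d σ) σ) = 1 := by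
  rw [antisymmetrizer_apply, coeff_sum, Finset.sum_eq_single 1]
  · simp [spinMonomial]
  · intro π _ hπ
    rw [coeff_smul, spinMonomial, Pi.single_apply]
    split_ifs with hσ
    · rw [rename_monomial, coeff_monomial, if_neg, smul_zero]
      intro hd
      refine hπ (Equiv.ext fun i => h (Prod.ext ?_ (congrFun hσ i)))
      have := DFunLike.congr_fun hd (π i)
      rw [Finsupp.mapDomain_apply π.injective] at this
      exact this.symm
    · simp
  · simp

theorem spinMonomial_mem_tensorSpin {W : Submodule ℂ (MvPolynomial (Fin N) ℂ)} {d : Fin N → ℕ}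
    (σ : Config N s) (h : monomial (Finsupp.equivFunOnFinite.symm d) 1 ∈ W) :
    spinMonomial d σ ∈ tensorSpin s W := by
  intro τ _
  rw [spinMonomial, Pi.single_apply]
  split_ifs
  · exact h
  · exact zero_mem _

theorem monomial_mem_rectModule {n : ℕ} {d : Fin N → ℕ} (h : ∀ i, d i ≤ n) :
    monomial (Finsupp.equivFunOnFinite.symm d) (1 : ℂ) ∈ rectModule N n :=
  (monomial_mem_restrictSupport ℂ).2 (Or.inl h)

theorem monomial_mem_triModule (d : Fin N → ℕ) :
    ∃ n, monomial (Finsupp.equivFunOnFinite.symm d) (1 : ℂ) ∈ triModule N n :=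
  ⟨_, (mem_restrictTotalDegree _ _ _).2 le_rfl⟩

/-- Fermions can be put into `(m + 1) (s + 1)` different one-particle states. -/
theorem exists_injective_states {m : ℕ} (h : N ≤ (m + 1) * (s + 1)) :
    ∃ (d : Fin N → ℕ) (σ : Config N s), (∀ i, d i ≤ m) ∧
      Function.Injective fun i => (d i, σ i) := by
  have hcard : Fintype.card (Fin N) ≤ Fintype.card (Fin (m + 1) × Fin (s + 1)) := by simpa using h
  obtain ⟨e⟩ := Function.Embedding.nonempty_of_card_le hcard
  refine ⟨fun i => (e i).1, fun i => (e i).2, fun i => Nat.le_of_lt_succ (e i).1.2,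
    fun i j hij => e.injective ?_⟩
  rw [Prod.mk.injEq] at hij
  exact Prod.ext (Fin.ext hij.1) hij.2

/-! ### Invariant spaces of functions -/

theorem finiteDimensional_tensorSpin (W : Submodule ℂ (MvPolynomial (Fin N) ℂ))
    [FiniteDimensional ℂ W] : FiniteDimensional ℂ (tensorSpin s W) := by
  let φ : tensorSpin s W →ₗ[ℂ] Config N s → W :=
    LinearMap.pi fun σ => ((LinearMap.proj σ).comp (tensorSpin s W).subtype).codRestrict W
      fun F => F.2 σ trivial
  refine FiniteDimensional.of_injective φ fun F G h => Subtype.ext (funext fun σ => ?_)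
  exact congrArg Subtype.val (congrFun h σ)

theorem Admissible.isInvariantSpace (A : Admissible p U ζ E)
    (W : Submodule ℂ (MvPolynomial (Fin N) ℂ)) [FiniteDimensional ℂ W]
    (hK : ∀ π, renameEnd π ∈ stabilizer W) (hT : gaugedHam N p ∈ stabilizer W) :
    IsInvariantSpace U (hamiltonian p U ζ)
      (((tensorSpin s W).map (antisymmetrizer N s)).map (pullback s p U ζ E)) := by
  have := finiteDimensional_tensorSpin (s := s) W
  refine ⟨inferInstance, ?_, ?_⟩
  · rintro _ ⟨F, -, rfl⟩
    exact A.pullback_mem_smoothFun F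
  · rintro _ ⟨Φ, hΦ, rfl⟩
    rw [SetLike.mem_coe, mem_map_antisymmetrizer hK] at hΦ
    rw [A.hamiltonian_pullback hΦ.1]
    refine Submodule.mem_map_of_mem (neg_mem ?_)
    exact (mem_map_antisymmetrizer hK).2
      ⟨hΦ.1.map (commute_gaugedHam p), fun σ => hT _ (hΦ.2 σ)⟩

instance (n : ℕ) : FiniteDimensional ℂ (rectModule N n) :=
  inferInstanceAs (Module.Finite ℂ (restrictDegree (Fin N) ℂ n))

instance (n : ℕ) : FiniteDimensional ℂ (triModule N n) :=
  inferInstanceAs (Module.Finite ℂ (restrictTotalDegree (Fin N) ℂ n))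

theorem rectModule_mono : Monotone (rectModule N) := fun _ _ h =>
  restrictSupport_mono ℂ fun _ hd i => (hd i).trans h

theorem triModule_mono : Monotone (triModule N) := fun _ _ h =>
  restrictSupport_mono ℂ fun _ hd => le_trans hd h

theorem monotone_map_antisymmetrizer {W : ℕ → Submodule ℂ (MvPolynomial (Fin N) ℂ)}
    (hW : Monotone W) : Monotone fun n =>
      ((tensorSpin s (W n)).map (antisymmetrizer N s)).map (pullback s p U ζ E) := fun _ _ h =>
  Submodule.map_mono (Submodule.map_mono (Submodule.pi_mono fun _ _ => hW h))

/-- If finitely many different spaces occurred, one of them, belonging to some `W_n`, would contain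
all others. By assumption the elements of `W_n` have no monomials with all exponents at least
`k`, for some `k`; taking `d_i = i + k` then gives an element `Λ (z^d |σ⟩)` outside `Λ(W_n ⊗ 𝔖)`. -/
theorem Admissible.infinite_range (A : Admissible p U ζ E) (hne : U.Nonempty)
    {W : ℕ → Submodule ℂ (MvPolynomial (Fin N) ℂ)} (hW : Monotone W)
    (hK : ∀ n π, renameEnd π ∈ stabilizer (W n))
    (hmem : ∀ d : Fin N → ℕ, ∃ n, monomial (Finsupp.equivFunOnFinite.symm d) (1 : ℂ) ∈ W n)
    (hbound : ∀ n, ∃ k, ∀ f ∈ W n, ∀ d : Fin N → ℕ, (∀ i, k ≤ d i) →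
      coeff (Finsupp.equivFunOnFinite.symm d) f = 0) :
    (Set.range fun n =>
      ((tensorSpin s (W n)).map (antisymmetrizer N s)).map (pullback s p U ζ E)).Infinite := by
  intro hfin
  set M : ℕ → Submodule ℂ (SpinFun N s) := fun n =>
    ((tensorSpin s (W n)).map (antisymmetrizer N s)).map (pullback s p U ζ E) with hM
  have hmono : Monotone M := monotone_map_antisymmetrizer hW
  obtain ⟨n, hn⟩ : ∃ n, ∀ l, M l ≤ M n := by
    obtain ⟨_, ⟨n, rfl⟩, hn⟩ := hfin.exists_maximal (Set.range_nonempty M)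
    refine ⟨n, fun l => ?_⟩
    rcases le_total l n with h | h
    · exact hmono h
    · exact hn ⟨l, rfl⟩ (hmono h)
  obtain ⟨k, hk⟩ := hbound n
  let d : Fin N → ℕ := fun i => i + k
  let σ : Config N s := fun _ => 0
  have hinj : Function.Injective fun i => (d i, σ i) := fun i j hij => by
    rw [Prod.mk.injEq] at hij
    exact Fin.ext (Nat.add_right_cancel hij.1)
  obtain ⟨l, hl⟩ := hmem d
  have hmem : pullback s p U ζ E (antisymmetrizer N s (spinMonomial d σ)) ∈ M n :=
    hn l (Submodule.mem_map_of_mem (Submodule.mem_map_of_mem (spinMonomial_mem_tensorSpin σ hl)))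
  obtain ⟨Φ, hΦ, hΦ'⟩ := hmem
  rw [A.pullback_injective hne hΦ'] at hΦ
  have h0 := hk _ (((mem_map_antisymmetrizer (hK n)).1 hΦ).2 σ) d fun i => Nat.le_add_left k i
  rw [coeff_antisymmetrizer_spinMonomial hinj] at h0
  exact one_ne_zero h0

theorem Admissible.modM_ne_bot (A : Admissible p U ζ E) (hne : U.Nonempty)
    (h : N ≤ (p.m + 1) * (s + 1)) : modM s p U ζ E p.m ≠ ⊥ := by
  obtain ⟨d, σ, hd, hinj⟩ := exists_injective_states h
  intro hbot
  have hmem : pullback s p U ζ E (antisymmetrizer N s (spinMonomial d σ)) ∈ modM s p U ζ E p.m :=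
    Submodule.mem_map_of_mem (Submodule.mem_map_of_mem
      (spinMonomial_mem_tensorSpin σ (monomial_mem_rectModule hd)))
  rw [hbot, Submodule.mem_bot] at hmem
  have h0 := coeff_antisymmetrizer_spinMonomial hinj
  rw [A.pullback_injective hne (hmem.trans (map_zero _).symm)] at h0
  simp at h0

theorem Admissible.infinite_range_modM (A : Admissible p U ζ E) (hne : U.Nonempty) (hN : 1 ≤ N) :
    (Set.range (modM s p U ζ E)).Infinite := by
  refine A.infinite_range hne rectModule_mono renameEnd_mem_stabilizer_rect (fun d => ?_)
    fun n => ⟨n + 1, fun f hf d hd => ?_⟩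
  · exact ⟨∑ i, d i, monomial_mem_rectModule fun i =>
      Finset.single_le_sum (f := d) (fun _ _ => Nat.zero_le _) (Finset.mem_univ i)⟩
  · rw [rectModule, mem_restrictDegree] at hf
    by_contra h0
    have h1 := hf _ (mem_support_iff.2 h0) ⟨0, hN⟩
    have h2 := hd ⟨0, hN⟩
    rw [Finsupp.equivFunOnFinite_symm_apply_apply] at h1
    omega

theorem Admissible.infinite_range_modN (A : Admissible p U ζ E) (hne : U.Nonempty) (hN : 1 ≤ N) :
    (Set.range (modN s p U ζ E)).Infinite := by
  refine A.infinite_range hne triModule_mono renameEnd_mem_stabilizer_tri monomial_mem_triModule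
    fun n => ⟨n + 1, fun f hf d hd => ?_⟩
  have hf' := restrictTotalDegree_le_restrictDegree _ _ n hf
  rw [mem_restrictDegree] at hf'
  by_contra h0
  have h1 := hf' _ (mem_support_iff.2 h0) ⟨0, hN⟩
  have h2 := hd ⟨0, hN⟩
  rw [Finsupp.equivFunOnFinite_symm_apply_apply] at h1
  omega

end SpinCS

end

theorem mainTheorem3 (N s : ℕ) (hN : 1 ≤ N) (p : SpinCS.Params)
    (U : Set (Fin N → ℝ)) (hU : IsOpen U) (hne : U.Nonempty)
    (ζ : Fin N → ℝ → ℝ) (E : ℝ → ℝ)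
    (hP : ∀ x ∈ U, ∀ i, 0 < (SpinCS.polyP p).eval (ζ i (x i)))
    (hζ : ∀ x ∈ U, ∀ i, ∃ d : ℝ, HasDerivAt (ζ i) d (x i) ∧
      d ^ 2 = (SpinCS.polyP p).eval (ζ i (x i)))
    (hdist : ∀ x ∈ U, ∀ i j, i ≠ j → ζ i (x i) ≠ ζ j (x j))
    (hE : ∀ x ∈ U, ∀ i, HasDerivAt E
      ((SpinCS.polyQt N p).eval (ζ i (x i)) / (2 * (SpinCS.polyP p).eval (ζ i (x i))))
      (ζ i (x i))) :
    SpinCS.IsInvariantSpace U (SpinCS.hamiltonian p U ζ) (SpinCS.modM s p U ζ E p.m) ∧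
    (N ≤ (p.m + 1) * (s + 1) →
      SpinCS.modM s p U ζ E p.m ≠ ⊥ ∧
      SpinCS.IsQuasiExactlySolvable (s := s) U (SpinCS.hamiltonian p U ζ)) ∧
    (p.cpp = 0 → p.c0p = 0 → p.cp = 0 →
      (∀ n : ℕ,
        SpinCS.IsInvariantSpace U (SpinCS.hamiltonian p U ζ) (SpinCS.modM s p U ζ E n) ∧
        SpinCS.IsInvariantSpace U (SpinCS.hamiltonian p U ζ) (SpinCS.modN s p U ζ E n)) ∧
      (Set.range (SpinCS.modM s p U ζ E)).Infinite ∧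
      (Set.range (SpinCS.modN s p U ζ E)).Infinite ∧
      SpinCS.IsExactlySolvable (s := s) U (SpinCS.hamiltonian p U ζ)) := by
  have A : SpinCS.Admissible p U ζ E := ⟨hU, hP, hζ, hdist, hE⟩
  have hinv : SpinCS.IsInvariantSpace U (SpinCS.hamiltonian p U ζ) (SpinCS.modM s p U ζ E p.m) :=
    A.isInvariantSpace _ (SpinCS.renameEnd_mem_stabilizer_rect _) (SpinCS.gaugedHam_rect p)
  refine ⟨hinv, fun h => ⟨A.modM_ne_bot hne h, _, A.modM_ne_bot hne h, hinv⟩, fun h1 h2 h3 => ?_⟩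
  have hM : ∀ n, SpinCS.IsInvariantSpace U (SpinCS.hamiltonian p U ζ)
      (SpinCS.modM s p U ζ E n) := fun n =>
    A.isInvariantSpace _ (SpinCS.renameEnd_mem_stabilizer_rect _)
      (SpinCS.gaugedHam_rect_of_eq_zero p ⟨h1, h2, h3⟩ n)
  have hNn : ∀ n, SpinCS.IsInvariantSpace U (SpinCS.hamiltonian p U ζ)
      (SpinCS.modN s p U ζ E n) := fun n =>
    A.isInvariantSpace _ (SpinCS.renameEnd_mem_stabilizer_tri _)
      (SpinCS.gaugedHam_tri_of_eq_zero p ⟨h1, h2, h3⟩ n)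
  exact ⟨fun n => ⟨hM n, hNn n⟩, A.infinite_range_modM hne hN, A.infinite_range_modN hne hN, _,
    SpinCS.monotone_map_antisymmetrizer SpinCS.rectModule_mono, A.infinite_range_modM hne hN, hM⟩
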